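/- Let $\mathcal H$ be a complex Hilbert space and let $(\mathfrak a_q)_{q>0}$ be closed nonnegative sesquilinear forms in $\mathcal H$ which all have the same domain $\mathcal H^1\subset\mathcal H$ and which increase as $q$ decreases, that is, $\mathfrak a_q[u,u]\ge \mathfrak a_{\tilde q}[u,u]$ for all $0<q<\tilde q<\infty$ and $u\in\mathcal H^1$. Define the limit form $\mathfrak a_0$ by $$\mathrm{dom}(\mathfrak a_0)=\Bigl\{u\in\mathcal H^1:\ \sup_{q>0}\mathfrak a_q[u,u]<\infty\Bigr\},\qquad \mathfrak a_0[u,v]=\lim_{q\to0}\mathfrak a_q[u,v],$$ and assume that $\mathrm{dom}(\mathfrak a_0)$, hence also $\mathcal H^1$, is dense in $\mathcal H$. For $q\ge 0$ let $\mathcal A_q$ be the operator associated with $\mathfrak a_q$ via the first representation theorem: $u\in\mathrm{dom}(\mathcal A_q)$ and $\mathcal A_qu=f$ if and only if $u\in\mathrm{dom}(\mathfrak a_q)$ and $\mathfrak a_q[u,v]=(f,v)_{\mathcal H}$ for all $v\in\mathrm{dom}(\mathfrak a_q)$. Assume that the spectrum of $\mathcal A_q$ is purely discrete for every $q\ge 0$,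 that is, it consists only of isolated points which are eigenvalues with finite-dimensional eigenspaces. Then, for every $q\ge0$, the eigenvalues of $\mathcal A_q$, counted with multiplicities, can be listed as a nondecreasing sequence $\lambda_1(\mathcal A_q)\le\lambda_2(\mathcal A_q)\le\cdots$ with $\dim\mathcal H$ entries (an infinite sequence indexed by $k=1,2,\dots$ if $\dim\mathcal H=\infty$), and for each index $k\in\mathbb N$ (with $k\le\dim\mathcal H$ if $\mathcal H$ is finite-dimensional) one has $$\lambda_k(\mathcal A_q)\to\lambda_k(\mathcal A_0)\quad\text{as } q\to0,\ q>0 .$$ -/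

import Mathlib

open Filter Topology
open scoped ComplexOrder InnerProductSpace

/-- A sesquilinear form in `H`, defined on a linear subspace. It is conjugate-linear in its
first and linear in its second argument, as Mathlib's inner product is. -/
structure SesqForm (H : Type*) [NormedAddCommGroup H] [InnerProductSpace ℂ H] where
  /-- the domain of the form -/
  domain : Submodule ℂ H
  /-- the values of the form -/
  form : domain →ₗ⋆[ℂ] domain →ₗ[ℂ] ℂ

namespace SesqForm

variable {H : Type*} [NormedAddCommGroup H] [InnerProductSpace ℂ H]

/-- A nonnegative form is closed if, whenever `uₙ ∈ dom a`, `uₙ → u` in `H` and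
`a[uₙ - uₘ, uₙ - uₘ] → 0`, one has `u ∈ dom a` and `a[uₙ - u, uₙ - u] → 0`. -/
def IsClosed (a : SesqForm H) : Prop :=
  ∀ (u : ℕ → a.domain) (x : H),
    Tendsto (fun n => (u n : H)) atTop (𝓝 x) →
    Tendsto (fun p : ℕ × ℕ => a.form (u p.1 - u p.2) (u p.1 - u p.2)) atTop (𝓝 0) →
    ∃ hx : x ∈ a.domain,
      Tendsto (fun n => a.form (u n - ⟨x, hx⟩) (u n - ⟨x, hx⟩)) atTop (𝓝 0)

/-- The pairs `(u, f)` with `u ∈ dom a` and `a[v, u] = ⟪v, f⟫` for all `v ∈ dom a`. -/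
def operatorGraph (a : SesqForm H) : Submodule ℂ (H × H) where
  carrier := {p | ∃ hu : p.1 ∈ a.domain, ∀ v : a.domain, a.form v ⟨p.1, hu⟩ = ⟪(v : H), p.2⟫_ℂ}
  add_mem' := by
    rintro p q ⟨hp, hp'⟩ ⟨hq, hq'⟩
    refine ⟨a.domain.add_mem hp hq, fun v => ?_⟩
    have h : (⟨(p + q).1, a.domain.add_mem hp hq⟩ : a.domain) = ⟨p.1, hp⟩ + ⟨q.1, hq⟩ := rfl
    rw [h, map_add, hp', hq', Prod.snd_add, inner_add_right]
  zero_mem' := by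
    refine ⟨a.domain.zero_mem, fun v => ?_⟩
    have h : (⟨(0 : H × H).1, a.domain.zero_mem⟩ : a.domain) = 0 := rfl
    rw [h, map_zero, Prod.snd_zero, inner_zero_right]
  smul_mem' := by
    rintro c p ⟨hp, hp'⟩
    refine ⟨a.domain.smul_mem c hp, fun v => ?_⟩
    have h : (⟨(c • p).1, a.domain.smul_mem c hp⟩ : a.domain) = c • ⟨p.1, hp⟩ := rfl
    rw [h, map_smul, hp', Prod.smul_snd, inner_smul_right, smul_eq_mul]

/-- The operator associated with a densely defined form via the first representation theorem:
`u ∈ dom A` and `A u = f` if and only if `u ∈ dom a` and `a[v, u] = ⟪v, f⟫` for all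
`v ∈ dom a` (see `mem_graph_operator`). -/
noncomputable def operator (a : SesqForm H) : H →ₗ.[ℂ] H :=
  a.operatorGraph.toLinearPMap

theorem mem_graph_operator (a : SesqForm H) (ha : Dense (a.domain : Set H)) (u f : H) :
    (u, f) ∈ a.operator.graph ↔
      ∃ hu : u ∈ a.domain, ∀ v : a.domain, a.form v ⟨u, hu⟩ = ⟪(v : H), f⟫_ℂ := by
  have key : ∀ (x : H × H) (_ : x ∈ a.operatorGraph) (_ : x.fst = 0), x.snd = 0 := by
    rintro ⟨x, y⟩ ⟨hx, hxy⟩ h0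
    obtain rfl : x = 0 := h0
    refine ha.eq_zero_of_inner_right ℂ (fun v hv => ?_)
    have h : (⟨(0 : H), hx⟩ : a.domain) = 0 := rfl
    have h2 := hxy ⟨v, hv⟩
    simp only [h, map_zero] at h2
    exact h2.symm
  rw [operator, Submodule.toLinearPMap_graph_eq _ key]
  exact Iff.rfl

end SesqForm

/-! ### Spectrum of an unbounded operator -/

namespace LinearPMap

variable {H : Type*} [NormedAddCommGroup H] [InnerProductSpace ℂ H]

/-- The eigenspace `ker (A - z)`. -/
def eigenspace (A : H →ₗ.[ℂ] H) (z : ℂ) : Submodule ℂ H :=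
  (LinearMap.ker (A.toFun - z • A.domain.subtype)).map A.domain.subtype

/-- The spectrum: all `z` for which `A - z : dom A → H` has no bounded everywhere defined
inverse `R`. -/
def spectrum (A : H →ₗ.[ℂ] H) : Set ℂ :=
  {z | ¬ ∃ R : H →L[ℂ] H,
    (∀ u : A.domain, R (A u - z • (u : H)) = u) ∧
    ∀ f : H, ∃ hf : R f ∈ A.domain, A ⟨R f, hf⟩ - z • R f = f}

/-- The discrete spectrum: the isolated points of the spectrum that are eigenvalues with a
finite-dimensional eigenspace. -/
def discreteSpectrum (A : H →ₗ.[ℂ] H) : Set ℂ :=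
  {z | z ∈ A.spectrum ∧ (∀ᶠ w in 𝓝[≠] z, w ∉ A.spectrum) ∧
    A.eigenspace z ≠ ⊥ ∧ FiniteDimensional ℂ (A.eigenspace z)}

/-- The essential spectrum: the complement of the discrete spectrum in the spectrum. -/
def essentialSpectrum (A : H →ₗ.[ℂ] H) : Set ℂ :=
  A.spectrum \ A.discreteSpectrum

/-- The spectrum is purely discrete if the essential spectrum is empty. -/
def HasPurelyDiscreteSpectrum (A : H →ₗ.[ℂ] H) : Prop :=
  A.essentialSpectrum = ∅

/-- The positions `1, 2, …, dim H` of the eigenvalues, which are all positive integers if `H` is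
infinite-dimensional. -/
def eigenvalueIndices (H : Type*) [NormedAddCommGroup H] [InnerProductSpace ℂ H] : Set ℕ :=
  {k | 1 ≤ k ∧ (k : ℕ∞) ≤ Cardinal.toENat (Module.rank ℂ H)}

/-- `ev 1 ≤ ev 2 ≤ …` (as many entries as the dimension of `H`) lists the eigenvalues of `A`,
each of them as often as its multiplicity says. -/
def IsEigenvalueSequence (A : H →ₗ.[ℂ] H) (ev : ℕ → ℝ) : Prop :=
  MonotoneOn ev (eigenvalueIndices H) ∧
    ∀ z : ℂ, {k ∈ eigenvalueIndices H | (ev k : ℂ) = z}.encard =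
      Cardinal.toENat (Module.rank ℂ (A.eigenspace z))

end LinearPMap

/-! ### The limit of a monotone family of forms -/

namespace SesqForm

variable {H : Type*} [NormedAddCommGroup H] [InnerProductSpace ℂ H]

/-- Nonnegative forms `a q`, `q > 0`, with the common domain `D`, that increase as `q`
decreases. The values `a q` for `q ≤ 0` play no role. -/
structure IsIncreasing {D : Submodule ℂ H} (a : ℝ → D →ₗ⋆[ℂ] D →ₗ[ℂ] ℂ) : Prop where
  nonneg : ∀ q, 0 < q → (a q).IsNonneg
  mono : ∀ q q', 0 < q → q < q' → ∀ u : D, a q' u u ≤ a q u u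

section limit

variable {D : Submodule ℂ H} {a : ℝ → D →ₗ⋆[ℂ] D →ₗ[ℂ] ℂ}

/-- `sup_{q > 0} a_q[u, u] < ∞`. -/
def IsBddAlong (a : ℝ → D →ₗ⋆[ℂ] D →ₗ[ℂ] ℂ) (u : D) : Prop :=
  BddAbove ((fun q => (a q u u).re) '' Set.Ioi 0)

theorem isBddAlong_iff (u : D) :
    IsBddAlong a u ↔ ∃ C : ℝ, ∀ q, 0 < q → (a q u u).re ≤ C := by
  constructor
  · rintro ⟨C, hC⟩
    exact ⟨C, fun q hq => hC ⟨q, hq, rfl⟩⟩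
  · rintro ⟨C, hC⟩
    refine ⟨C, ?_⟩
    rintro _ ⟨q, hq, rfl⟩
    exact hC q hq

theorem IsBddAlong.add (ha : IsIncreasing a) {u v : D} (hu : IsBddAlong a u)
    (hv : IsBddAlong a v) : IsBddAlong a (u + v) := by
  rw [isBddAlong_iff] at *
  obtain ⟨C, hC⟩ := hu
  obtain ⟨C', hC'⟩ := hv
  refine ⟨2 * C + 2 * C', fun q hq => ?_⟩
  have h1 := hC q hq
  have h2 := hC' q hq
  have h3 := (Complex.nonneg_iff.1 ((ha.nonneg q hq).nonneg (u - v))).1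
  simp only [map_add, map_sub, LinearMap.add_apply, LinearMap.sub_apply, Complex.add_re,
    Complex.sub_re] at h3 ⊢
  linarith

theorem IsBddAlong.smul (c : ℂ) {u : D} (hu : IsBddAlong a u) : IsBddAlong a (c • u) := by
  rw [isBddAlong_iff] at *
  obtain ⟨C, hC⟩ := hu
  refine ⟨Complex.normSq c * C, fun q hq => ?_⟩
  have h : a q (c • u) (c • u) = (Complex.normSq c : ℂ) * a q u u := by
    rw [Complex.normSq_eq_conj_mul_self]
    simp only [LinearMap.map_smulₛₗ, LinearMap.smul_apply, map_smul, smul_eq_mul]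
    ring
  rw [h, Complex.re_ofReal_mul]
  exact mul_le_mul_of_nonneg_left (hC q hq) (Complex.normSq_nonneg c)

theorem tendsto_diag (ha : IsIncreasing a) {u : D} (hu : IsBddAlong a u) :
    ∃ l : ℂ, Tendsto (fun q => a q u u) (𝓝[>] 0) (𝓝 l) := by
  have hanti : AntitoneOn (fun q => (a q u u).re) (Set.Ioi 0) := by
    intro q hq q' _ hqq
    rcases hqq.eq_or_lt with h | h
    · rw [h]
    · exact (Complex.le_def.1 (ha.mono q q' hq h u)).1
  refine ⟨_, ((Complex.continuous_ofReal.tendsto _).comp (hanti.tendsto_nhdsGT hu)).congr' ?_⟩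
  filter_upwards [self_mem_nhdsWithin] with q hq
  have h := (Complex.nonneg_iff.1 ((ha.nonneg q hq).nonneg u)).2
  exact Complex.ext (by simp) (by simpa using h)

theorem tendsto_form (ha : IsIncreasing a) {u v : D} (hu : IsBddAlong a u)
    (hv : IsBddAlong a v) : ∃ l : ℂ, Tendsto (fun q => a q u v) (𝓝[>] 0) (𝓝 l) := by
  have hI := hv.smul Complex.I
  have hn : ∀ {w : D}, IsBddAlong a w → IsBddAlong a (-w) := fun {w} hw => by
    simpa using hw.smul (-1)
  obtain ⟨l1, h1⟩ := tendsto_diag ha (hu.add ha hv)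
  obtain ⟨l2, h2⟩ := tendsto_diag ha (hu.add ha (hn hv))
  obtain ⟨l3, h3⟩ := tendsto_diag ha (hu.add ha hI)
  obtain ⟨l4, h4⟩ := tendsto_diag ha (hu.add ha (hn hI))
  refine ⟨_, ((((h1.sub h2).sub (h3.const_mul Complex.I)).add
    (h4.const_mul Complex.I)).const_mul (1 / 4)).congr fun q => ?_⟩
  simp only [map_add, map_neg, LinearMap.add_apply, LinearMap.neg_apply, LinearMap.map_smulₛₗ,
    LinearMap.smul_apply, map_smul, smul_eq_mul, Complex.conj_I]
  linear_combination (1 / 2 * (a q v u - a q u v)) * Complex.I_sq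

/-- The domain of the limit form: all `u ∈ D` with `sup_{q > 0} a_q[u, u] < ∞`. -/
def limitDomain (a : ℝ → D →ₗ⋆[ℂ] D →ₗ[ℂ] ℂ) (ha : IsIncreasing a) : Submodule ℂ H where
  carrier := {x | ∃ hx : x ∈ D, IsBddAlong a ⟨x, hx⟩}
  add_mem' := by
    rintro x y ⟨hx, hx'⟩ ⟨hy, hy'⟩
    exact ⟨D.add_mem hx hy, hx'.add ha hy'⟩
  zero_mem' := ⟨D.zero_mem, by
    rw [isBddAlong_iff]
    refine ⟨0, fun q _ => ?_⟩
    have h : (⟨0, D.zero_mem⟩ : D) = 0 := rfl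
    simp [h]⟩
  smul_mem' := by
    rintro c x ⟨hx, hx'⟩
    exact ⟨D.smul_mem c hx, hx'.smul c⟩

theorem limitDomain_le (ha : IsIncreasing a) : limitDomain a ha ≤ D := fun _ hx => hx.1

theorem tendsto_limUnder (ha : IsIncreasing a) (u v : limitDomain a ha) :
    Tendsto (fun q => a q (Submodule.inclusion (limitDomain_le ha) u)
      (Submodule.inclusion (limitDomain_le ha) v)) (𝓝[>] 0)
      (𝓝 (limUnder (𝓝[>] (0 : ℝ)) fun q => a q (Submodule.inclusion (limitDomain_le ha) u)
        (Submodule.inclusion (limitDomain_le ha) v))) :=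
  tendsto_nhds_limUnder (tendsto_form ha u.2.2 v.2.2)

/-- The limit form `a₀[u, v] = lim_{q → 0} a_q[u, v]` on `limitDomain`; the limit exists by
`tendsto_limitForm`. -/
noncomputable def limitForm (a : ℝ → D →ₗ⋆[ℂ] D →ₗ[ℂ] ℂ) (ha : IsIncreasing a) :
    SesqForm H where
  domain := limitDomain a ha
  form := LinearMap.mk₂'ₛₗ (starRingEnd ℂ) (RingHom.id ℂ)
    (fun u v => limUnder (𝓝[>] (0 : ℝ)) fun q =>
      a q (Submodule.inclusion (limitDomain_le ha) u) (Submodule.inclusion (limitDomain_le ha) v))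
    (fun u u' v => tendsto_nhds_unique (tendsto_limUnder ha (u + u') v)
      (((tendsto_limUnder ha u v).add (tendsto_limUnder ha u' v)).congr fun q => by simp))
    (fun c u v => tendsto_nhds_unique (tendsto_limUnder ha (c • u) v)
      (((tendsto_limUnder ha u v).const_mul (starRingEnd ℂ c)).congr fun q => by simp))
    (fun u v v' => tendsto_nhds_unique (tendsto_limUnder ha u (v + v'))
      (((tendsto_limUnder ha u v).add (tendsto_limUnder ha u v')).congr fun q => by simp))
    (fun c u v => tendsto_nhds_unique (tendsto_limUnder ha u (c • v))
      (((tendsto_limUnder ha u v).const_mul c).congr fun q => by simp))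

theorem tendsto_limitForm (ha : IsIncreasing a) (u v : (limitForm a ha).domain) :
    Tendsto (fun q => a q ⟨u, limitDomain_le ha u.2⟩ ⟨v, limitDomain_le ha v.2⟩) (𝓝[>] 0)
      (𝓝 ((limitForm a ha).form u v)) :=
  tendsto_limUnder ha u v

end limit

end SesqForm

/-! Everything is expressed by one predicate: `HasTestSpace k C`, a `k`-dimensional space of vectors
on which the form is at most `C ‖x‖ ^ 2`. By the min-max principle (`hasTestSpace_iff`,
`le_iff_le_ncard`) the `k`-th eigenvalue is at most `C` exactly when such a space exists, so no
infimum over subspaces is needed.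

The sublevel sets of the limit form are the intersections of those of the `a q`. A test space for
the limit is therefore one for every `q`. Conversely, purely discrete spectrum makes each sublevel
set compact within the unit ball, so the orthonormal `k`-families spanning test spaces for `a q`
form compact sets that shrink as `q` decreases; if all are nonempty, a common family exists and
spans a test space for the limit (`hasTestSpace_limitForm_iff`). Hence the `k`-th limit eigenvalue
is at most `C` iff the `k`-th eigenvalue for every `q > 0` is, and monotonicity in `q` turns this
into convergence.

Both ingredients rest on an orthonormal basis of eigenvectors (`nonempty_eigenbasis`). It comes from
the functional calculus of the bounded self-adjoint operator `(A + 1)⁻¹`, whose spectrum away from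
`0` is discrete. -/

namespace SesqForm

variable {H : Type*} [NormedAddCommGroup H] [InnerProductSpace ℂ H]

/-! ### The form domain as a Hilbert space -/

theorem form_self_eq_re {a : SesqForm H} (ha : a.form.IsNonneg) (u : a.domain) :
    a.form u u = ((a.form u u).re : ℂ) :=
  Complex.ext (by simp) (by simpa using (Complex.nonneg_iff.1 (ha.nonneg u)).2.symm)

theorem form_self_re_nonneg {a : SesqForm H} (ha : a.form.IsNonneg) (u : a.domain) :
    0 ≤ (a.form u u).re :=
  (Complex.nonneg_iff.1 (ha.nonneg u)).1

/-- Polarization: the diagonal values at `u + v` and `u + I • v` are real, which gives the imaginary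
and the real part of the identity. -/
theorem conj_form_symm {a : SesqForm H} (ha : a.form.IsNonneg) (u v : a.domain) :
    starRingEnd ℂ (a.form v u) = a.form u v := by
  have him : ∀ w, (a.form w w).im = 0 := fun w => (Complex.nonneg_iff.1 (ha.nonneg w)).2.symm
  have h1 := him (u + v)
  have h2 := him (u + Complex.I • v)
  have hu := him u
  have hv := him v
  simp [map_add, LinearMap.add_apply] at h1 h2
  apply Complex.ext
  · simp only [Complex.conj_re]; linarith
  · simp only [Complex.conj_im]; linarith

/-- The form domain, as an inner product space for `a[u, v] + ⟪u, v⟫`. -/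
def FormSpace (a : SesqForm H) (_ : a.form.IsNonneg) : Type _ := a.domain

namespace FormSpace

variable {a : SesqForm H} {ha : a.form.IsNonneg}

instance : AddCommGroup (FormSpace a ha) := inferInstanceAs (AddCommGroup a.domain)

instance : Module ℂ (FormSpace a ha) := inferInstanceAs (Module ℂ a.domain)

/-- The identification of `FormSpace a ha` with the domain of the form. -/
def toDomain : FormSpace a ha ≃ₗ[ℂ] a.domain := LinearEquiv.refl ℂ a.domain

/-- The inner product `a[u, v] + ⟪u, v⟫` on the form domain. -/
@[reducible]
noncomputable def core (a : SesqForm H) (ha : a.form.IsNonneg) :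
    InnerProductSpace.Core ℂ (FormSpace a ha) where
  inner u v := a.form (toDomain u) (toDomain v) + ⟪(toDomain u : H), (toDomain v : H)⟫_ℂ
  conj_inner_symm u v := by
    rw [map_add, conj_form_symm ha, inner_conj_symm]
  re_inner_nonneg u := by
    rw [map_add]
    exact add_nonneg (form_self_re_nonneg ha _) inner_self_nonneg
  add_left u v w := by
    rw [map_add, map_add, LinearMap.add_apply, Submodule.coe_add, inner_add_left]
    ring
  smul_left u v c := by
    rw [map_smul, LinearMap.map_smulₛₗ, LinearMap.smul_apply, smul_eq_mul, Submodule.coe_smul,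
      inner_smul_left]
    ring
  definite u hu := by
    have h1 := form_self_re_nonneg ha (toDomain u)
    have h2 := congrArg Complex.re hu
    have h3 : (⟪(toDomain u : H), (toDomain u : H)⟫_ℂ).re = ‖(toDomain u : H)‖ ^ 2 :=
      inner_self_eq_norm_sq (𝕜 := ℂ) _
    rw [Complex.add_re, h3, Complex.zero_re] at h2
    have h4 : ‖(toDomain u : H)‖ = 0 := by
      nlinarith [sq_nonneg ‖(toDomain u : H)‖]
    exact toDomain.map_eq_zero_iff.1 (Subtype.ext (norm_eq_zero.1 h4))

noncomputable instance : NormedAddCommGroup (FormSpace a ha) := (core a ha).toNormedAddCommGroup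

noncomputable instance : InnerProductSpace ℂ (FormSpace a ha) :=
  InnerProductSpace.ofCore (core a ha).toCore

theorem inner_eq (u v : FormSpace a ha) :
    ⟪u, v⟫_ℂ = a.form (toDomain u) (toDomain v) + ⟪(toDomain u : H), (toDomain v : H)⟫_ℂ := rfl

theorem norm_sq_eq (u : FormSpace a ha) :
    ‖u‖ ^ 2 = (a.form (toDomain u) (toDomain u)).re + ‖(toDomain u : H)‖ ^ 2 := by
  rw [← inner_self_eq_norm_sq (𝕜 := ℂ) u, ← inner_self_eq_norm_sq (𝕜 := ℂ) (toDomain u : H),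
    inner_eq, map_add]
  rfl

/-- The inclusion of the form domain into the Hilbert space. -/
noncomputable def incl (a : SesqForm H) (ha : a.form.IsNonneg) : FormSpace a ha →L[ℂ] H :=
  LinearMap.mkContinuous (a.domain.subtype ∘ₗ toDomain.toLinearMap) 1 (fun u => by
    rw [one_mul]
    refine abs_le_of_sq_le_sq' ?_ (norm_nonneg u) |>.2
    rw [norm_sq_eq]
    exact le_add_of_nonneg_left (form_self_re_nonneg ha _))

theorem incl_apply (u : FormSpace a ha) : incl a ha u = (toDomain u : H) := rfl

theorem incl_injective : Function.Injective (incl a ha) :=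
  fun _ _ h => toDomain.injective (Subtype.ext h)

/-- A Cauchy sequence for the form norm converges in `H` and is Cauchy for `a`, which is what
closedness of the form takes as input. -/
theorem completeSpace [CompleteSpace H] (hc : a.IsClosed) : CompleteSpace (FormSpace a ha) := by
  refine Metric.complete_of_cauchySeq_tendsto fun u hu => ?_
  obtain ⟨x, hx⟩ := cauchySeq_tendsto_of_complete ((incl a ha).uniformContinuous.comp_cauchySeq hu)
  have h0 : Tendsto (fun p : ℕ × ℕ => ‖u p.1 - u p.2‖ ^ 2) atTop (𝓝 0) := by
    have := cauchySeq_iff_tendsto_dist_atTop_0.1 hu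
    simpa [dist_eq_norm] using this.pow 2
  have h1 : Tendsto (fun p : ℕ × ℕ => (a.form (toDomain (u p.1) - toDomain (u p.2))
      (toDomain (u p.1) - toDomain (u p.2))).re) atTop (𝓝 0) :=
    squeeze_zero (fun p => form_self_re_nonneg ha _)
      (fun p => by
        have h := norm_sq_eq (u p.1 - u p.2)
        rw [map_sub] at h
        rw [h]
        exact le_add_of_nonneg_right (sq_nonneg _)) h0
  have h2 := (Complex.continuous_ofReal.tendsto 0).comp h1
  rw [Complex.ofReal_zero] at h2
  obtain ⟨hxD, hlim⟩ := hc (fun n => toDomain (u n)) x hx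
    (h2.congr fun p => (form_self_eq_re ha _).symm)
  refine ⟨toDomain.symm ⟨x, hxD⟩, ?_⟩
  rw [tendsto_iff_norm_sub_tendsto_zero]
  have h3 : Tendsto (fun n => ‖incl a ha (u n) - x‖ ^ 2) atTop (𝓝 0) := by
    simpa using (tendsto_iff_norm_sub_tendsto_zero.1 hx).pow 2
  have h4 := ((Complex.continuous_re.tendsto _).comp hlim).add h3
  rw [Complex.zero_re, add_zero] at h4
  have h5 : Tendsto (fun n => ‖u n - toDomain.symm ⟨x, hxD⟩‖ ^ 2) atTop (𝓝 0) := by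
    refine h4.congr fun n => ?_
    rw [norm_sq_eq, map_sub, toDomain.apply_symm_apply]
    rfl
  simpa using h5.sqrt

end FormSpace

end SesqForm

/-! ### Spectrum and eigenspaces in terms of the graph -/

namespace LinearPMap

variable {H : Type*} [NormedAddCommGroup H] [InnerProductSpace ℂ H]

theorem mem_eigenspace_iff (A : H →ₗ.[ℂ] H) (z : ℂ) (x : H) :
    x ∈ A.eigenspace z ↔ (x, z • x) ∈ A.graph := by
  rw [LinearPMap.mem_graph_iff]
  constructor
  · rintro ⟨y, hy, rfl⟩
    exact ⟨y, rfl, sub_eq_zero.1 hy⟩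
  · rintro ⟨y, rfl, hy⟩
    exact ⟨y, sub_eq_zero.2 hy, rfl⟩

theorem exists_inverse_of_notMem_spectrum {A : H →ₗ.[ℂ] H} {z : ℂ} (hz : z ∉ A.spectrum) :
    ∃ S : H →L[ℂ] H, (∀ u g, (u, g) ∈ A.graph → S (g - z • u) = u) ∧
      ∀ f, (S f, f + z • S f) ∈ A.graph := by
  obtain ⟨S, h1, h2⟩ := not_not.1 hz
  refine ⟨S, fun u g hug => ?_, fun f => ?_⟩
  · obtain ⟨y, rfl, rfl⟩ := (LinearPMap.mem_graph_iff A).1 hug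
    exact h1 y
  · obtain ⟨hf, hf'⟩ := h2 f
    exact (LinearPMap.mem_graph_iff A).2 ⟨⟨S f, hf⟩, rfl, sub_eq_iff_eq_add.1 hf'⟩

theorem HasPurelyDiscreteSpectrum.mem_discreteSpectrum {A : H →ₗ.[ℂ] H}
    (hA : A.HasPurelyDiscreteSpectrum) {z : ℂ} (hz : z ∈ A.spectrum) : z ∈ A.discreteSpectrum := by
  by_contra h
  exact (hA.subset ⟨hz, h⟩ : z ∈ (∅ : Set ℂ))

theorem eigenspace_eq_bot_of_notMem_spectrum {A : H →ₗ.[ℂ] H} {z : ℂ} (hz : z ∉ A.spectrum) :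
    A.eigenspace z = ⊥ := by
  obtain ⟨S, h1, -⟩ := exists_inverse_of_notMem_spectrum hz
  refine (Submodule.eq_bot_iff _).2 fun x hx => ?_
  have := h1 x _ ((mem_eigenspace_iff A z x).1 hx)
  rw [sub_self] at this
  exact this.symm.trans S.map_zero

theorem HasPurelyDiscreteSpectrum.finiteDimensional_eigenspace {A : H →ₗ.[ℂ] H}
    (hA : A.HasPurelyDiscreteSpectrum) (z : ℂ) : FiniteDimensional ℂ (A.eigenspace z) := by
  by_cases hz : z ∈ A.spectrum
  · exact (hA.mem_discreteSpectrum hz).2.2.2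
  · rw [eigenspace_eq_bot_of_notMem_spectrum hz]
    infer_instance

end LinearPMap

/-! ### The resolvent at `-1` and completeness of the eigenvectors -/

namespace SesqForm

variable {H : Type*} [NormedAddCommGroup H] [InnerProductSpace ℂ H] [CompleteSpace H]
  {a : SesqForm H} {ha : a.form.IsNonneg} [CompleteSpace (FormSpace a ha)]

open FormSpace

/-- The operator `(A + 1)⁻¹`. -/
noncomputable def resolvent (a : SesqForm H) (ha : a.form.IsNonneg)
    [CompleteSpace (FormSpace a ha)] : H →L[ℂ] H :=
  incl a ha ∘L ContinuousLinearMap.adjoint (incl a ha)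

theorem isSelfAdjoint_resolvent : IsSelfAdjoint (resolvent a ha) := by
  rw [ContinuousLinearMap.isSelfAdjoint_iff', resolvent, ContinuousLinearMap.adjoint_comp,
    ContinuousLinearMap.adjoint_adjoint]

/-- The adjoint of the inclusion sends `f` to the `w` with `a[v, w] + ⟪v, w⟫ = ⟪v, f⟫` for all `v`,
which says `A w = f - w`. -/
theorem mem_graph_iff_resolvent (hd : Dense (a.domain : Set H)) (u g : H) :
    (u, g) ∈ a.operator.graph ↔ resolvent a ha (g + u) = u := by
  rw [mem_graph_operator a hd]
  constructor
  · rintro ⟨hu, h⟩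
    have key : ContinuousLinearMap.adjoint (incl a ha) (g + u) = toDomain.symm ⟨u, hu⟩ := by
      refine ext_inner_left ℂ fun v => ?_
      rw [ContinuousLinearMap.adjoint_inner_right, inner_eq, toDomain.apply_symm_apply, h,
        inner_add_right]
      rfl
    rw [resolvent, ContinuousLinearMap.comp_apply, key, incl_apply, toDomain.apply_symm_apply]
  · intro h
    set w := ContinuousLinearMap.adjoint (incl a ha) (g + u) with hw
    have hwu : (toDomain w : H) = u := h
    refine ⟨hwu ▸ (toDomain w).2, fun v => ?_⟩
    have h1 : ⟪toDomain.symm v, w⟫_ℂ = ⟪(v : H), g + u⟫_ℂ := by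
      rw [hw, ContinuousLinearMap.adjoint_inner_right, incl_apply, toDomain.apply_symm_apply]
    rw [inner_eq, toDomain.apply_symm_apply, inner_add_right, hwu, add_left_inj] at h1
    rw [← h1]
    congr 1
    exact Subtype.ext hwu.symm

theorem mem_eigenspace_iff_resolvent (hd : Dense (a.domain : Set H)) (z : ℂ) (x : H) :
    x ∈ a.operator.eigenspace z ↔ (z + 1) • resolvent a ha x = x := by
  rw [LinearPMap.mem_eigenspace_iff, mem_graph_iff_resolvent (ha := ha) hd, map_add, map_smul,
    add_smul, one_smul]

/-- With `R = (A + 1)⁻¹` one has `w - R = w R (A - (w⁻¹ - 1))`. If `S` inverts the last factor, the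
inverse is `w⁻¹ S (A + 1) = w⁻¹ (1 + w⁻¹ S)`. -/
theorem notMem_spectrum_resolvent (hd : Dense (a.domain : Set H)) {w : ℂ} (hw : w ≠ 0)
    (h : w⁻¹ - 1 ∉ a.operator.spectrum) : w ∉ spectrum ℂ (resolvent a ha) := by
  obtain ⟨S, h1, h2⟩ := LinearPMap.exists_inverse_of_notMem_spectrum h
  rw [spectrum.notMem_iff]
  refine (isUnit_iff_exists.2 ⟨w⁻¹ • (1 + w⁻¹ • S), ?_, ?_⟩)
  · ext f
    have h3 := (mem_graph_iff_resolvent (ha := ha) hd _ _).1 (h2 f)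
    have h4 : f + (w⁻¹ - 1) • S f + S f = f + w⁻¹ • S f := by
      rw [sub_smul, one_smul]; abel
    rw [h4] at h3
    simp only [Algebra.algebraMap_eq_smul_one, mul_apply_eq_comp,
      sub_apply, smul_apply, add_apply,
      one_apply_eq_self, map_smul, h3]
    rw [smul_add, smul_inv_smul₀ hw, add_sub_cancel_right, inv_smul_smul₀ hw]
  · ext f
    have h3 : (resolvent a ha f, f - resolvent a ha f) ∈ a.operator.graph :=
      (mem_graph_iff_resolvent (ha := ha) hd _ _).2 (by rw [sub_add_cancel])
    have h4 := h1 _ _ h3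
    have h5 : f - resolvent a ha f - (w⁻¹ - 1) • resolvent a ha f
        = w⁻¹ • (w • f - resolvent a ha f) := by
      rw [smul_sub, inv_smul_smul₀ hw, sub_smul, one_smul]; abel
    rw [h5, map_smul] at h4
    simp only [Algebra.algebraMap_eq_smul_one, mul_apply_eq_comp,
      sub_apply, smul_apply, add_apply,
      one_apply_eq_self, h4]
    rw [sub_add_cancel, inv_smul_smul₀ hw]

theorem eventually_notMem_spectrum_resolvent (hd : Dense (a.domain : Set H))
    (hA : a.operator.HasPurelyDiscreteSpectrum) {t : ℝ} (ht : t ≠ 0)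
    (hts : t ∈ spectrum ℝ (resolvent a ha)) :
    ∀ᶠ s in 𝓝[≠] t, s ∉ spectrum ℝ (resolvent a ha) := by
  have hc : (t : ℂ) ≠ 0 := Complex.ofReal_ne_zero.2 ht
  have h1 : (t : ℂ)⁻¹ - 1 ∈ a.operator.spectrum := by
    by_contra h
    exact notMem_spectrum_resolvent hd hc h ((spectrum.algebraMap_mem_iff ℂ).2 hts)
  have h2 := (hA.mem_discreteSpectrum h1).2.1
  have h3 : Tendsto (fun s : ℝ => (s : ℂ)⁻¹ - 1) (𝓝[≠] t) (𝓝[≠] ((t : ℂ)⁻¹ - 1)) := by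
    refine tendsto_nhdsWithin_iff.2 ⟨?_, ?_⟩
    · exact (((Complex.continuous_ofReal.tendsto t).inv₀ hc).sub_const 1).mono_left
        nhdsWithin_le_nhds
    · filter_upwards [self_mem_nhdsWithin] with s hs h
      exact hs (Complex.ofReal_injective (inv_injective (sub_left_injective h)))
  have h4 : ∀ᶠ s : ℝ in 𝓝[≠] t, s ≠ 0 :=
    eventually_nhdsWithin_of_eventually_nhds (isOpen_ne.mem_nhds ht)
  filter_upwards [h3.eventually h2, h4] with s hs hs0 h
  exact notMem_spectrum_resolvent hd (Complex.ofReal_ne_zero.2 hs0) hs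
    ((spectrum.algebraMap_mem_iff ℂ).2 h)

/-- The set is compact, so if infinite it would have an accumulation point in itself; but nonzero
spectral points are isolated. -/
theorem finite_spectrum_resolvent (hd : Dense (a.domain : Set H))
    (hA : a.operator.HasPurelyDiscreteSpectrum) {ε : ℝ} (hε : 0 < ε) :
    {t ∈ spectrum ℝ (resolvent a ha) | ε ≤ |t|}.Finite := by
  by_contra hinf
  have hK : IsCompact {t ∈ spectrum ℝ (resolvent a ha) | ε ≤ |t|} :=
    (spectrum.isCompact (𝕜 := ℝ) (resolvent a ha)).inter_right
      (isClosed_le continuous_const continuous_abs)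
  obtain ⟨t, ⟨hts, htε⟩, hacc⟩ := Set.Infinite.exists_accPt_of_subset_isCompact hinf hK subset_rfl
  have h1 := eventually_notMem_spectrum_resolvent hd hA (abs_pos.1 (hε.trans_le htε)) hts
  rw [accPt_iff_frequently_nhdsNE] at hacc
  exact hacc (h1.mono fun s hs h => hs h.1)

theorem resolvent_injective (hd : Dense (a.domain : Set H)) :
    Function.Injective (resolvent a ha) := by
  rw [injective_iff_map_eq_zero]
  intro f hf
  have h1 := (mem_graph_iff_resolvent (ha := ha) hd 0 f).2 (by rwa [add_zero])
  exact LinearPMap.graph_fst_eq_zero_snd _ h1 rfl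

/-- Since `t` is isolated in the spectrum, its indicator is admissible in the continuous functional
calculus and yields a spectral projection. -/
theorem continuousOn_ite_eq_spectrum (hd : Dense (a.domain : Set H))
    (hA : a.operator.HasPurelyDiscreteSpectrum) {t : ℝ} (ht : t ≠ 0)
    (hts : t ∈ spectrum ℝ (resolvent a ha)) :
    ContinuousOn (fun s : ℝ => if s = t then (1 : ℝ) else 0) (spectrum ℝ (resolvent a ha)) := by
  intro s hs
  by_cases hst : s = t
  · subst hst
    refine Tendsto.congr' ?_ tendsto_const_nhds
    have h1 := eventually_nhdsWithin_iff.1 (eventually_notMem_spectrum_resolvent hd hA ht hts)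
    filter_upwards [eventually_nhdsWithin_of_eventually_nhds h1, self_mem_nhdsWithin] with r h2 h3
    have : r = s := by
      by_contra h
      exact h2 h h3
    rw [this]
  · refine Tendsto.congr' ?_ tendsto_const_nhds
    filter_upwards [eventually_nhdsWithin_of_eventually_nhds (isOpen_ne.mem_nhds hst)] with r hr
    rw [if_neg hst, if_neg hr]

/-- The projection `P` satisfies `R P = t P`, so its range consists of eigenvectors of `A` for `t⁻¹
- 1`. These are orthogonal to `x`, and `P` is self-adjoint. -/
theorem cfc_resolvent_apply_eq_zero (hd : Dense (a.domain : Set H))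
    (hA : a.operator.HasPurelyDiscreteSpectrum) {x : H}
    (hx : ∀ z : ℝ, ∀ y ∈ a.operator.eigenspace z, ⟪y, x⟫_ℂ = 0) {t : ℝ} (ht : t ≠ 0)
    (hts : t ∈ spectrum ℝ (resolvent a ha)) :
    cfc (fun s : ℝ => if s = t then (1 : ℝ) else 0) (resolvent a ha) x = 0 := by
  set R := resolvent a ha with hR
  have hsa : IsSelfAdjoint R := isSelfAdjoint_resolvent
  set P := cfc (fun s : ℝ => if s = t then (1 : ℝ) else 0) R with hP
  have hcont := continuousOn_ite_eq_spectrum hd hA ht hts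
  have hPsa : IsSelfAdjoint P := cfc_predicate _ _
  have hRP : R * P = t • P := by
    rw [hP, ← cfc_smul _ _ _ hcont]
    nth_rw 1 [← cfc_id' ℝ R]
    rw [← cfc_mul (fun s : ℝ => s) _ _ continuousOn_id hcont]
    refine cfc_congr fun s _ => ?_
    by_cases h : s = t <;> simp [h]
  refine ext_inner_left ℂ fun y => ?_
  rw [inner_zero_right, ← ContinuousLinearMap.adjoint_inner_left, hPsa.adjoint_eq]
  refine hx (t⁻¹ - 1) _ ((mem_eigenspace_iff_resolvent (ha := ha) hd _ _).2 ?_)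
  have h := congrArg (fun T : H →L[ℂ] H => T y) hRP
  simp only [mul_apply_eq_comp, smul_apply] at h
  rw [← hR, h, Complex.ofReal_sub, Complex.ofReal_one, sub_add_cancel, Complex.ofReal_inv,
    ← Complex.coe_smul, inv_smul_smul₀ (Complex.ofReal_ne_zero.2 ht)]

/-- Subtracting from `R` its finitely many spectral parts with `|t| ≥ ε` leaves an operator of norm
at most `ε` and does not change `R x`. So `R x = 0`, and `R` is injective. -/
theorem eq_zero_of_orthogonal_eigenspaces (ha : a.form.IsNonneg)
    [CompleteSpace (FormSpace a ha)] (hd : Dense (a.domain : Set H))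
    (hA : a.operator.HasPurelyDiscreteSpectrum) {x : H}
    (hx : ∀ z : ℝ, ∀ y ∈ a.operator.eigenspace z, ⟪y, x⟫_ℂ = 0) : x = 0 := by
  set R := resolvent a ha with hR
  have hsa : IsSelfAdjoint R := isSelfAdjoint_resolvent
  suffices h : ∀ ε > 0, ‖R x‖ ≤ ε * ‖x‖ by
    refine resolvent_injective (ha := ha) hd ?_
    rw [map_zero, ← norm_le_zero_iff]
    refine le_of_tendsto_of_tendsto (b := 𝓝[>] (0 : ℝ)) (f := fun _ => ‖R x‖)
      (g := fun ε => ε * ‖x‖) tendsto_const_nhds ?_ (eventually_mem_nhdsWithin.mono h)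
    have : Tendsto (fun ε : ℝ => ε * ‖x‖) (𝓝 0) (𝓝 (0 * ‖x‖)) := tendsto_id.mul_const _
    rw [zero_mul] at this
    exact this.mono_left nhdsWithin_le_nhds
  intro ε hε
  set F := (finite_spectrum_resolvent (ha := ha) hd hA hε).toFinset with hF
  have hmem : ∀ t, t ∈ F ↔ t ∈ spectrum ℝ R ∧ ε ≤ |t| := fun t => by simp [hF, hR]
  have hne : ∀ t ∈ F, t ≠ 0 := fun t ht => abs_pos.1 (hε.trans_le ((hmem t).1 ht).2)
  have hcont : ∀ t ∈ F, ContinuousOn (fun s : ℝ => t * if s = t then (1 : ℝ) else 0)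
      (spectrum ℝ R) := fun t ht =>
    continuousOn_const.mul (continuousOn_ite_eq_spectrum hd hA (hne t ht) ((hmem t).1 ht).1)
  have hzero : cfc (∑ t ∈ F, fun s : ℝ => t * if s = t then (1 : ℝ) else 0) R x = 0 := by
    rw [cfc_sum _ _ F hcont, sum_apply]
    refine Finset.sum_eq_zero fun t ht => ?_
    have hc := continuousOn_ite_eq_spectrum hd hA (hne t ht) ((hmem t).1 ht).1
    rw [cfc_const_mul _ _ _ hc, smul_apply,
      cfc_resolvent_apply_eq_zero hd hA hx (hne t ht) ((hmem t).1 ht).1, smul_zero]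
  have hsub : R x = cfc (fun s : ℝ => s - (∑ t ∈ F, fun s : ℝ => t * if s = t then (1 : ℝ) else 0) s)
      R x := by
    have hc : ContinuousOn (∑ t ∈ F, fun s : ℝ => t * if s = t then (1 : ℝ) else 0)
        (spectrum ℝ R) :=
      (continuousOn_finsetSum F hcont).congr fun s _ => Finset.sum_apply s F _
    rw [cfc_sub (fun s : ℝ => s) _ R continuousOn_id hc, sub_apply, hzero, sub_zero, cfc_id' ℝ R]
  rw [hsub]
  refine (ContinuousLinearMap.le_opNorm _ _).trans ?_
  gcongr
  refine norm_cfc_le hε.le fun s hs => ?_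
  rw [Finset.sum_apply]
  by_cases hsF : s ∈ F
  · rw [Finset.sum_eq_single_of_mem s hsF (fun t _ hts => by rw [if_neg hts.symm, mul_zero])]
    simpa using hε.le
  · rw [Finset.sum_eq_zero fun t ht => ?_]
    · rw [sub_zero, Real.norm_eq_abs]
      by_contra h
      exact hsF ((hmem s).2 ⟨hs, (not_le.1 h).le⟩)
    · rw [if_neg (fun h : s = t => hsF (h ▸ ht)), mul_zero]

end SesqForm

/-! ### Orthonormal bases of eigenvectors -/

namespace SesqForm

open FormSpace

section Eigen

variable {H : Type*} [NormedAddCommGroup H] [InnerProductSpace ℂ H] {a : SesqForm H}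

theorem mem_eigenspace_operator_iff (hd : Dense (a.domain : Set H)) (z : ℂ) (x : H) :
    x ∈ a.operator.eigenspace z ↔
      ∃ hx : x ∈ a.domain, ∀ v : a.domain, a.form v ⟨x, hx⟩ = z * ⟪(v : H), x⟫_ℂ := by
  rw [LinearPMap.mem_eigenspace_iff, mem_graph_operator a hd]
  simp only [inner_smul_right]

theorem eigenvalue_nonneg (ha : a.form.IsNonneg) (hd : Dense (a.domain : Set H)) {z : ℂ} {x : H}
    (hx : x ∈ a.operator.eigenspace z) (hx0 : x ≠ 0) : 0 ≤ z := by
  obtain ⟨hxD, h⟩ := (mem_eigenspace_operator_iff hd z x).1 hx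
  have h1 := h ⟨x, hxD⟩
  have h2 := ha.nonneg ⟨x, hxD⟩
  rw [h1, inner_self_eq_norm_sq_to_K] at h2
  have h3 : 0 < ‖x‖ ^ 2 := by positivity
  have h4 : ((‖x‖ : ℝ) : ℂ) ^ 2 = ((‖x‖ ^ 2 : ℝ) : ℂ) := by push_cast; rfl
  rw [RCLike.ofReal_eq_complex_ofReal, h4, Complex.nonneg_iff, Complex.re_mul_ofReal,
    Complex.im_mul_ofReal] at h2
  exact Complex.nonneg_iff.2 ⟨nonneg_of_mul_nonneg_left h2.1 h3,
    ((mul_eq_zero.1 h2.2.symm).resolve_right h3.ne').symm⟩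

theorem eigenspace_eq_bot_of_im_ne_zero (ha : a.form.IsNonneg) (hd : Dense (a.domain : Set H))
    {z : ℂ} (hz : z.im ≠ 0) : a.operator.eigenspace z = ⊥ := by
  refine (Submodule.eq_bot_iff _).2 fun x hx => ?_
  by_contra h
  exact hz (Complex.nonneg_iff.1 (eigenvalue_nonneg ha hd hx h)).2.symm

theorem inner_eigenvectors_eq_zero (ha : a.form.IsNonneg) (hd : Dense (a.domain : Set H)) {z w : ℝ}
    (hzw : z ≠ w) {x y : H} (hx : x ∈ a.operator.eigenspace z) (hy : y ∈ a.operator.eigenspace w) :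
    ⟪x, y⟫_ℂ = 0 := by
  obtain ⟨hxD, h⟩ := (mem_eigenspace_operator_iff hd _ _).1 hx
  obtain ⟨hyD, h'⟩ := (mem_eigenspace_operator_iff hd _ _).1 hy
  have h1 := h ⟨y, hyD⟩
  have h2 := h' ⟨x, hxD⟩
  rw [← conj_form_symm ha, h1, map_mul, inner_conj_symm, Complex.conj_ofReal] at h2
  have h3 : ((z : ℂ) - w) * ⟪x, y⟫_ℂ = 0 := by rw [sub_mul, h2, sub_self]
  refine (mul_eq_zero.1 h3).resolve_left ?_
  exact sub_ne_zero.2 (fun h => hzw (Complex.ofReal_injective h))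

theorem orthogonalFamily_eigenspaces (ha : a.form.IsNonneg) (hd : Dense (a.domain : Set H)) :
    OrthogonalFamily ℂ (fun z : ℝ => a.operator.eigenspace z)
      (fun z : ℝ => (a.operator.eigenspace z).subtypeₗᵢ) :=
  fun _ _ hzw x y => inner_eigenvectors_eq_zero ha hd hzw x.2 y.2

/-- An orthonormal basis of eigenvectors of the operator of `a`, with finitely many eigenvalues
below each bound, and with as many basis vectors for each eigenvalue as its multiplicity says. -/
structure Eigenbasis (a : SesqForm H) where
  /-- the index type -/
  ι : Type
  /-- the basis vectors -/
  basis : HilbertBasis ι ℂ H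
  /-- the eigenvalues -/
  eigenvalue : ι → ℝ
  mem_eigenspace : ∀ i, basis i ∈ a.operator.eigenspace (eigenvalue i)
  finite_le : ∀ C, {i | eigenvalue i ≤ C}.Finite
  encard_eq : ∀ z : ℂ, {i | (eigenvalue i : ℂ) = z}.encard =
    Cardinal.toENat (Module.rank ℂ (a.operator.eigenspace z))

end Eigen

variable {H : Type*} [NormedAddCommGroup H] [InnerProductSpace ℂ H] [CompleteSpace H]
  {a : SesqForm H}

/-- The map `z ↦ (z + 1)⁻¹` embeds these eigenvalues into the part of the resolvent's spectrum
bounded away from `0` by `(C + 1)⁻¹`. -/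
theorem finite_eigenvalues_le (ha : a.form.IsNonneg) [CompleteSpace (FormSpace a ha)]
    (hd : Dense (a.domain : Set H)) (hA : a.operator.HasPurelyDiscreteSpectrum) (C : ℝ) :
    {z : ℝ | a.operator.eigenspace z ≠ ⊥ ∧ z ≤ C}.Finite := by
  have hnn : ∀ z : ℝ, a.operator.eigenspace z ≠ ⊥ → 0 ≤ z := by
    intro z hz
    obtain ⟨x, hx, hx0⟩ := Submodule.exists_mem_ne_zero_of_ne_bot hz
    exact Complex.zero_le_real.1 (eigenvalue_nonneg ha hd hx hx0)
  rcases lt_or_ge C 0 with hC | hC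
  · convert Set.finite_empty (α := ℝ)
    ext z
    simp only [Set.mem_ofPred_eq, Set.mem_empty_iff_false, iff_false, not_and]
    exact fun hz hzC => absurd (hnn z hz) (by linarith)
  have hinj : Set.InjOn (fun z : ℝ => (z + 1)⁻¹)
      {z : ℝ | a.operator.eigenspace z ≠ ⊥ ∧ z ≤ C} := fun z _ w _ h =>
    add_right_cancel (inv_injective h)
  refine Set.Finite.of_finite_image (Set.Finite.subset
    (finite_spectrum_resolvent (ha := ha) hd hA (ε := (C + 1)⁻¹) (by positivity)) ?_) hinj
  rintro _ ⟨z, ⟨hz, hzC⟩, rfl⟩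
  have hz0 := hnn z hz
  refine ⟨?_, ?_⟩
  · obtain ⟨x, hx, hx0⟩ := Submodule.exists_mem_ne_zero_of_ne_bot hz
    rw [mem_eigenspace_iff_resolvent (ha := ha) hd] at hx
    rw [spectrum.mem_iff]
    rintro ⟨u, hu⟩
    refine hx0 ?_
    have hz1 : (z : ℂ) + 1 ≠ 0 := by
      have : z + 1 ≠ 0 := by positivity
      exact_mod_cast this
    have h0 : (u : H →L[ℂ] H) x = 0 := by
      rw [hu, sub_apply, Algebra.algebraMap_eq_smul_one, smul_apply, one_apply_eq_self,
        ← inv_smul_smul₀ hz1 (resolvent a ha x), hx, ← Complex.coe_smul, Complex.ofReal_inv,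
        Complex.ofReal_add, Complex.ofReal_one, sub_self]
    have h1 : ((↑u⁻¹ : H →L[ℂ] H) * (u : H →L[ℂ] H)) x = x := by
      rw [Units.inv_mul, one_apply_eq_self]
    rw [← h1, mul_apply_eq_comp, h0, map_zero]
  · rw [abs_of_pos (by positivity)]
    exact inv_anti₀ (by positivity) (by linarith)

theorem nonempty_eigenbasis (ha : a.form.IsNonneg) (hc : a.IsClosed)
    (hd : Dense (a.domain : Set H)) (hA : a.operator.HasPurelyDiscreteSpectrum) :
    Nonempty (Eigenbasis a) := by
  have : CompleteSpace (FormSpace a ha) := completeSpace hc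
  have := hA.finiteDimensional_eigenspace
  -- An orthonormal basis of each real eigenspace; fibres over non-eigenvalues are empty, so the
  -- index counts multiplicities exactly.
  let v : (Σ z : ℝ, Fin (Module.finrank ℂ (a.operator.eigenspace z))) → H :=
    fun i => (stdOrthonormalBasis ℂ (a.operator.eigenspace i.1) i.2 : H)
  have hv : Orthonormal ℂ v :=
    (orthogonalFamily_eigenspaces ha hd).orthonormal_sigma_orthonormal
      (fun z => (stdOrthonormalBasis ℂ (a.operator.eigenspace z)).orthonormal)
  have hmem : ∀ i, v i ∈ a.operator.eigenspace i.1 := fun i => Subtype.coe_prop _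
  have hbot : (Submodule.span ℂ (Set.range v))ᗮ = ⊥ := by
    refine (Submodule.eq_bot_iff _).2 fun x hx => ?_
    refine eq_zero_of_orthogonal_eigenspaces ha hd hA fun z y hy => ?_
    refine Submodule.inner_right_of_mem_orthogonal (K := Submodule.span ℂ (Set.range v)) ?_ hx
    have h1 : (⟨y, hy⟩ : a.operator.eigenspace z) ∈
        Submodule.span ℂ (Set.range (stdOrthonormalBasis ℂ (a.operator.eigenspace z))) := by
      rw [← OrthonormalBasis.coe_toBasis, Module.Basis.span_eq]
      trivial
    have h2 := Submodule.mem_map_of_mem (f := (a.operator.eigenspace z).subtype) h1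
    rw [Submodule.map_span] at h2
    refine Submodule.span_mono ?_ h2
    rintro _ ⟨_, ⟨j, rfl⟩, rfl⟩
    exact ⟨⟨z, j⟩, rfl⟩
  refine ⟨_, HilbertBasis.mkOfOrthogonalEqBot hv hbot, fun i => i.1, fun i => ?_, fun C => ?_,
    fun z => ?_⟩
  · rw [HilbertBasis.coe_mkOfOrthogonalEqBot]
    exact hmem i
  · refine Set.Finite.subset ((finite_eigenvalues_le ha hd hA C).preimage'
      (f := (Sigma.fst : (Σ z : ℝ, Fin (Module.finrank ℂ (a.operator.eigenspace z))) → ℝ))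
      fun z _ => ?_) ?_
    · refine (Set.finite_range (Sigma.mk z)).subset ?_
      rintro ⟨w, j⟩ rfl
      exact ⟨j, rfl⟩
    · rintro ⟨w, j⟩ hi
      refine ⟨fun h => ?_, hi⟩
      have h0 : Module.finrank ℂ (a.operator.eigenspace w) = 0 := by
        rw [h, finrank_bot]
      exact (Fin.cast h0 j).elim0
  · by_cases hz : z.im = 0
    · obtain ⟨r, rfl⟩ : ∃ r : ℝ, z = (r : ℂ) := ⟨z.re, Complex.ext rfl hz⟩
      have : {i : (Σ z : ℝ, Fin (Module.finrank ℂ (a.operator.eigenspace z))) |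
          (i.1 : ℂ) = (r : ℂ)} = Set.range (Sigma.mk r) := by
        ext ⟨w, j⟩
        constructor
        · intro h
          obtain rfl : w = r := Complex.ofReal_injective h
          exact ⟨j, rfl⟩
        · rintro ⟨j, hj⟩
          cases hj
          rfl
      rw [this, ← Set.image_univ, Function.Injective.encard_image sigma_mk_injective,
        Set.encard_univ, ENat.card_eq_coe_fintype_card, Fintype.card_fin, ← Module.finrank_eq_rank]
      simp
    · rw [eigenspace_eq_bot_of_im_ne_zero ha hd hz, rank_bot, map_zero, Set.encard_eq_zero]
      ext i
      simp only [Set.mem_ofPred_eq, Set.mem_empty_iff_false, iff_false]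
      rintro rfl
      exact hz (Complex.ofReal_im _)

end SesqForm

/-! ### Eigenvector expansions, closedness and compactness of sublevel sets -/

theorem HilbertBasis.hasSum_norm_inner_sq {ι H : Type*} [NormedAddCommGroup H]
    [InnerProductSpace ℂ H] (b : HilbertBasis ι ℂ H) (x : H) :
    HasSum (fun i => ‖⟪b i, x⟫_ℂ‖ ^ 2) (‖x‖ ^ 2) := by
  have h := Complex.hasSum_re (b.hasSum_inner_mul_inner x x)
  have h1 : (⟪x, x⟫_ℂ).re = ‖x‖ ^ 2 := inner_self_eq_norm_sq (𝕜 := ℂ) x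
  rw [h1] at h
  refine h.congr_fun fun i => ?_
  rw [← inner_conj_symm x, Complex.conj_mul']
  norm_cast

namespace SesqForm

open FormSpace

variable {H : Type*} [NormedAddCommGroup H] [InnerProductSpace ℂ H]

/-- The vectors of the form domain with `a[x, x] ≤ C`. -/
def sublevel (a : SesqForm H) (C : ℝ) : Set H :=
  {x | ∃ hx : x ∈ a.domain, (a.form ⟨x, hx⟩ ⟨x, hx⟩).re ≤ C}

namespace Eigenbasis

variable {a : SesqForm H} (B : Eigenbasis a)

theorem mem_domain (hd : Dense (a.domain : Set H)) (i : B.ι) : B.basis i ∈ a.domain :=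
  ((mem_eigenspace_operator_iff hd _ _).1 (B.mem_eigenspace i)).1

theorem eigenvalue_nonneg (ha : a.form.IsNonneg) (hd : Dense (a.domain : Set H)) (i : B.ι) :
    0 ≤ B.eigenvalue i :=
  Complex.zero_le_real.1
    (SesqForm.eigenvalue_nonneg ha hd (B.mem_eigenspace i) (B.basis.orthonormal.ne_zero i))

theorem form_basis_left (ha : a.form.IsNonneg) (hd : Dense (a.domain : Set H)) (i : B.ι)
    (v : a.domain) :
    a.form ⟨B.basis i, B.mem_domain hd i⟩ v = B.eigenvalue i * ⟪B.basis i, (v : H)⟫_ℂ := by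
  obtain ⟨_, h⟩ := (mem_eigenspace_operator_iff hd _ _).1 (B.mem_eigenspace i)
  rw [← conj_form_symm ha, h, map_mul, Complex.conj_ofReal, inner_conj_symm]

/-- The eigenvectors, normalized in the form domain. -/
noncomputable def formVec (ha : a.form.IsNonneg) (hd : Dense (a.domain : Set H)) (i : B.ι) :
    FormSpace a ha :=
  (((√(B.eigenvalue i + 1))⁻¹ : ℝ) : ℂ) • toDomain.symm ⟨B.basis i, B.mem_domain hd i⟩

theorem inner_formVec (ha : a.form.IsNonneg) (hd : Dense (a.domain : Set H)) (i : B.ι)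
    (v : FormSpace a ha) :
    ⟪B.formVec ha hd i, v⟫_ℂ = (√(B.eigenvalue i + 1) : ℝ) * ⟪B.basis i, incl a ha v⟫_ℂ := by
  have h0 : 0 < B.eigenvalue i + 1 := by linarith [B.eigenvalue_nonneg ha hd i]
  have h1 : ((√(B.eigenvalue i + 1) : ℝ) : ℂ) ≠ 0 :=
    Complex.ofReal_ne_zero.2 (Real.sqrt_pos.2 h0).ne'
  have h2 : ((√(B.eigenvalue i + 1) : ℝ) : ℂ) * (√(B.eigenvalue i + 1) : ℝ)
      = B.eigenvalue i + 1 := by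
    rw [← Complex.ofReal_mul, Real.mul_self_sqrt h0.le]
    push_cast; rfl
  rw [formVec, inner_smul_left, Complex.conj_ofReal, inner_eq, toDomain.apply_symm_apply,
    B.form_basis_left ha hd, ← incl_apply, Complex.ofReal_inv, inv_mul_eq_iff_eq_mul₀ h1,
    ← mul_assoc, h2]
  ring

theorem orthonormal_formVec (ha : a.form.IsNonneg) (hd : Dense (a.domain : Set H)) :
    Orthonormal ℂ (B.formVec ha hd) := by
  classical
  rw [orthonormal_iff_ite]
  intro i j
  have h0 : 0 < B.eigenvalue i + 1 := by linarith [B.eigenvalue_nonneg ha hd i]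
  have h1 : ((√(B.eigenvalue i + 1) : ℝ) : ℂ) ≠ 0 :=
    Complex.ofReal_ne_zero.2 (Real.sqrt_pos.2 h0).ne'
  have h2 : incl a ha (B.formVec ha hd j) =
      (((√(B.eigenvalue j + 1))⁻¹ : ℝ) : ℂ) • B.basis j := by
    rw [formVec, map_smul, incl_apply, toDomain.apply_symm_apply]
  rw [inner_formVec, h2, inner_smul_right, orthonormal_iff_ite.1 B.basis.orthonormal]
  split_ifs with h
  · rw [← h, mul_one, Complex.ofReal_inv, mul_inv_cancel₀ h1]
  · simp

theorem eq_of_forall_inner_eq {x y : H} (h : ∀ i, ⟪B.basis i, x⟫_ℂ = ⟪B.basis i, y⟫_ℂ) : x = y := by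
  refine B.basis.repr.injective (Subtype.ext (funext fun i => ?_))
  exact (B.basis.repr_apply_apply x i).trans ((h i).trans (B.basis.repr_apply_apply y i).symm)

/-- The normalized eigenvectors, as an orthonormal basis of the form domain. -/
noncomputable def formBasis (ha : a.form.IsNonneg) (hd : Dense (a.domain : Set H))
    [CompleteSpace (FormSpace a ha)] : HilbertBasis B.ι ℂ (FormSpace a ha) :=
  HilbertBasis.mkOfOrthogonalEqBot (B.orthonormal_formVec ha hd) (by
    refine (Submodule.eq_bot_iff _).2 fun x hx => incl_injective ?_
    refine B.eq_of_forall_inner_eq fun i => ?_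
    have h := Submodule.inner_right_of_mem_orthogonal
      (Submodule.subset_span (Set.mem_range_self i)) hx
    have h0 : 0 < B.eigenvalue i + 1 := by linarith [B.eigenvalue_nonneg ha hd i]
    rw [inner_formVec] at h
    rw [map_zero, inner_zero_right]
    exact (mul_eq_zero.1 h).resolve_left (Complex.ofReal_ne_zero.2 (Real.sqrt_pos.2 h0).ne'))

theorem norm_inner_formBasis_sq (ha : a.form.IsNonneg) (hd : Dense (a.domain : Set H))
    [CompleteSpace (FormSpace a ha)] (i : B.ι) (v : FormSpace a ha) :
    ‖⟪B.formBasis ha hd i, v⟫_ℂ‖ ^ 2 =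
      (B.eigenvalue i + 1) * ‖⟪B.basis i, incl a ha v⟫_ℂ‖ ^ 2 := by
  have h0 : 0 < B.eigenvalue i + 1 := by linarith [B.eigenvalue_nonneg ha hd i]
  rw [formBasis, HilbertBasis.coe_mkOfOrthogonalEqBot, inner_formVec, norm_mul, mul_pow,
    Complex.norm_real, Real.norm_eq_abs, sq_abs, Real.sq_sqrt h0.le]

variable [CompleteSpace H]

/-- The difference of Parseval's identities in the form domain and in `H`. -/
theorem hasSum_form (ha : a.form.IsNonneg) (hc : a.IsClosed) (hd : Dense (a.domain : Set H))
    (x : a.domain) :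
    HasSum (fun i => B.eigenvalue i * ‖⟪B.basis i, (x : H)⟫_ℂ‖ ^ 2) (a.form x x).re := by
  have : CompleteSpace (FormSpace a ha) := completeSpace hc
  have h1 := (B.formBasis ha hd).hasSum_norm_inner_sq (toDomain.symm x)
  have h2 := B.basis.hasSum_norm_inner_sq (x : H)
  have h3 := h1.sub h2
  rw [norm_sq_eq, toDomain.apply_symm_apply, add_sub_cancel_right] at h3
  refine h3.congr_fun fun i => ?_
  rw [norm_inner_formBasis_sq, incl_apply, toDomain.apply_symm_apply]
  ring

/-- Riesz–Fischer in the form domain: the coefficients define an element there, and its image in `H`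
has the same coefficients as `x`. -/
theorem mem_domain_of_summable (ha : a.form.IsNonneg) (hc : a.IsClosed)
    (hd : Dense (a.domain : Set H)) {x : H}
    (hx : Summable fun i => B.eigenvalue i * ‖⟪B.basis i, x⟫_ℂ‖ ^ 2) : x ∈ a.domain := by
  have : CompleteSpace (FormSpace a ha) := completeSpace hc
  have h0 : ∀ i, 0 < B.eigenvalue i + 1 := fun i => by linarith [B.eigenvalue_nonneg ha hd i]
  have hmem : Memℓp (fun i => ((√(B.eigenvalue i + 1) : ℝ) : ℂ) * ⟪B.basis i, x⟫_ℂ) 2 := by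
    refine memℓp_gen ((hx.add (B.basis.hasSum_norm_inner_sq x).summable).congr fun i => ?_)
    rw [ENNReal.toReal_ofNat, Real.rpow_two, norm_mul, mul_pow, Complex.norm_real,
      Real.norm_eq_abs, sq_abs, Real.sq_sqrt (h0 i).le]
    ring
  have h1 : incl a ha ((B.formBasis ha hd).repr.symm ⟨_, hmem⟩) = x := by
    refine B.eq_of_forall_inner_eq fun i => ?_
    have h2 := (B.formBasis ha hd).repr_apply_apply ((B.formBasis ha hd).repr.symm ⟨_, hmem⟩) i
    rw [LinearIsometryEquiv.apply_symm_apply, formBasis, HilbertBasis.coe_mkOfOrthogonalEqBot,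
      inner_formVec] at h2
    exact (mul_left_cancel₀ (Complex.ofReal_ne_zero.2 (Real.sqrt_pos.2 (h0 i)).ne') h2).symm
  rw [← h1]
  exact (toDomain _).2

/-- Bounded partial sums already force membership in the form domain. Each partial sum is continuous
on `H`, so sublevel sets are closed in `H`. -/
theorem mem_sublevel_iff (ha : a.form.IsNonneg) (hc : a.IsClosed) (hd : Dense (a.domain : Set H))
    {x : H} {C : ℝ} : x ∈ a.sublevel C ↔
      ∀ s : Finset B.ι, ∑ i ∈ s, B.eigenvalue i * ‖⟪B.basis i, x⟫_ℂ‖ ^ 2 ≤ C := by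
  have hnn : ∀ i, 0 ≤ B.eigenvalue i * ‖⟪B.basis i, x⟫_ℂ‖ ^ 2 := fun i =>
    mul_nonneg (B.eigenvalue_nonneg ha hd i) (sq_nonneg _)
  constructor
  · rintro ⟨hx, hxC⟩ s
    exact (sum_le_hasSum s (fun i _ => hnn i) (B.hasSum_form ha hc hd ⟨x, hx⟩)).trans hxC
  · intro h
    have hx := B.mem_domain_of_summable ha hc hd (summable_of_sum_le hnn h)
    exact ⟨hx, hasSum_le_of_sum_le (B.hasSum_form ha hc hd ⟨x, hx⟩) h⟩

theorem isClosed_sublevel (B : Eigenbasis a) (ha : a.form.IsNonneg) (hc : a.IsClosed)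
    (hd : Dense (a.domain : Set H)) (C : ℝ) : _root_.IsClosed (a.sublevel C) := by
  have : a.sublevel C = ⋂ s : Finset B.ι,
      {x | ∑ i ∈ s, B.eigenvalue i * ‖⟪B.basis i, x⟫_ℂ‖ ^ 2 ≤ C} := by
    ext x
    rw [B.mem_sublevel_iff ha hc hd, Set.mem_iInter]
    rfl
  rw [this]
  exact isClosed_iInter fun s => isClosed_le (by fun_prop) continuous_const

/-- Only finitely many eigenvalues lie below a large `M`. Dropping the other coefficients costs at
most `C / M` in squared norm, and the truncations lie in a compact finite-dimensional set. -/
theorem isCompact_sublevel (B : Eigenbasis a) (ha : a.form.IsNonneg) (hc : a.IsClosed)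
    (hd : Dense (a.domain : Set H)) (C : ℝ) : IsCompact (a.sublevel C ∩ Metric.closedBall 0 1) := by
  classical
  refine isCompact_iff_totallyBounded_isComplete.2 ⟨?_,
    ((B.isClosed_sublevel ha hc hd C).inter Metric.isClosed_closedBall).isComplete⟩
  rw [Metric.totallyBounded_iff]
  intro ε hε
  -- Chosen so that `M * (ε / 2) ^ 2 = |C| + 1 > C`; the absolute value keeps `M` positive for every
  -- `C`.
  set M := (|C| + 1) * (4 / ε ^ 2) with hM
  have hM0 : 0 < M := by positivity
  set s := (B.finite_le M).toFinset with hs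
  let K : Set H := (fun c : s → ℂ => ∑ i, c i • B.basis i) '' Metric.closedBall 0 1
  have hK : IsCompact K := (isCompact_closedBall _ _).image (by fun_prop)
  obtain ⟨t, ht, hKt⟩ := Metric.totallyBounded_iff.1 hK.totallyBounded (ε / 2) (by positivity)
  refine ⟨t, ht, ?_⟩
  rintro x ⟨hx, hx1⟩
  rw [mem_closedBall_zero_iff] at hx1
  set y := ∑ i : s, ⟪B.basis i, x⟫_ℂ • B.basis i with hy
  have hyK : y ∈ K := by
    refine ⟨fun i => ⟪B.basis i, x⟫_ℂ, ?_, rfl⟩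
    rw [mem_closedBall_zero_iff, pi_norm_le_iff_of_nonneg zero_le_one]
    intro i
    refine (norm_inner_le_norm _ _).trans ?_
    rwa [B.basis.orthonormal.1, one_mul]
  have hinner : ∀ i, ⟪B.basis i, y⟫_ℂ = if i ∈ s then ⟪B.basis i, x⟫_ℂ else 0 := by
    intro i
    rw [hy, Finset.sum_coe_sort s (fun i => ⟪B.basis i, x⟫_ℂ • B.basis i), inner_sum]
    simp only [inner_smul_right, orthonormal_iff_ite.1 B.basis.orthonormal, mul_ite, mul_one,
      mul_zero, Finset.sum_ite_eq]
  have hle : M * ‖x - y‖ ^ 2 ≤ C := by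
    refine hasSum_le_of_sum_le ((B.basis.hasSum_norm_inner_sq (x - y)).mul_left M) fun r => ?_
    refine (Finset.sum_le_sum fun i _ => ?_).trans ((B.mem_sublevel_iff ha hc hd).1 hx r)
    rw [inner_sub_right, hinner]
    split_ifs with h
    · rw [sub_self, norm_zero]
      have := mul_nonneg (B.eigenvalue_nonneg ha hd i) (sq_nonneg ‖⟪B.basis i, x⟫_ℂ‖)
      simpa using this
    · rw [sub_zero]
      have : M ≤ B.eigenvalue i := by
        by_contra h'
        exact h ((B.finite_le M).mem_toFinset.2 (not_le.1 h').le)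
      gcongr
  have hlt : ‖x - y‖ < ε / 2 := by
    refine lt_of_pow_lt_pow_left₀ 2 (by positivity) ?_
    have h1 : C < M * (ε / 2) ^ 2 := by
      have : M * (ε / 2) ^ 2 = |C| + 1 := by
        rw [hM]; field_simp; norm_num
      rw [this]
      linarith [le_abs_self C]
    exact lt_of_mul_lt_mul_left (hle.trans_lt h1) hM0.le
  obtain ⟨w, hw, hwy⟩ := Set.mem_iUnion₂.1 (hKt hyK)
  refine Set.mem_iUnion₂.2 ⟨w, hw, ?_⟩
  rw [Metric.mem_ball] at hwy ⊢
  rw [← dist_eq_norm] at hlt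
  linarith [dist_triangle x y w]

end Eigenbasis

end SesqForm

/-! ### Min-max by counting, and listing the eigenvalues -/

/-- In infinite dimension a Hilbert basis may be smaller than an algebraic one, but both counts are
`⊤` in `ℕ∞`. -/
theorem HilbertBasis.encard_eq_rank {ι H : Type*} [NormedAddCommGroup H]
    [InnerProductSpace ℂ H] (b : HilbertBasis ι ℂ H) :
    ENat.card ι = Cardinal.toENat (Module.rank ℂ H) := by
  cases finite_or_infinite ι
  · cases nonempty_fintype ι
    have h := b.toOrthonormalBasis.toBasis
    rw [rank_eq_card_basis h]
    simp
  · have h := b.orthonormal.linearIndependent.aleph0_le_rank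
    rw [ENat.card_eq_top_of_infinite, eq_comm]
    exact Cardinal.toENat_eq_top.2 h

namespace SesqForm

variable {H : Type*} [NormedAddCommGroup H] [InnerProductSpace ℂ H]

/-- There is a `k`-dimensional subspace of the form domain, given by an orthonormal family, on
which `a[x, x] ≤ C ‖x‖ ^ 2`. -/
def HasTestSpace (a : SesqForm H) (k : ℕ) (C : ℝ) : Prop :=
  ∃ x : Fin k → H, Orthonormal ℂ x ∧
    ∀ c : Fin k → ℂ, ∑ j, c j • x j ∈ a.sublevel (C * ∑ j, ‖c j‖ ^ 2)

end SesqForm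

theorem Orthonormal.norm_sum_smul_sq {ι H : Type*} [Fintype ι] [NormedAddCommGroup H]
    [InnerProductSpace ℂ H] {x : ι → H} (hx : Orthonormal ℂ x) (c : ι → ℂ) :
    ‖∑ j, c j • x j‖ ^ 2 = ∑ j, ‖c j‖ ^ 2 := by
  rw [← inner_self_eq_norm_sq (𝕜 := ℂ), hx.inner_sum, map_sum]
  refine Finset.sum_congr rfl fun j _ => ?_
  rw [Complex.conj_mul']
  norm_cast

namespace SesqForm.Eigenbasis

open FormSpace

variable {H : Type*} [NormedAddCommGroup H] [InnerProductSpace ℂ H] {a : SesqForm H}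

/-- If `k` exceeds the number of eigenvalues up to `C`, a dimension count gives a nonzero test
vector orthogonal to their eigenvectors, and there the form exceeds `C ‖y‖ ^ 2`. Otherwise `k` of
these eigenvectors span a test space. -/
theorem hasTestSpace_iff [CompleteSpace H] (B : Eigenbasis a) (ha : a.form.IsNonneg)
    (hc : a.IsClosed) (hd : Dense (a.domain : Set H)) (k : ℕ) (C : ℝ) :
    a.HasTestSpace k C ↔ k ≤ {i | B.eigenvalue i ≤ C}.ncard := by
  classical
  have hfin := B.finite_le C
  have := hfin.to_subtype
  have := Fintype.ofFinite {i | B.eigenvalue i ≤ C}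
  have hcard : {i | B.eigenvalue i ≤ C}.ncard = Fintype.card {i | B.eigenvalue i ≤ C} := by
    rw [← Nat.card_coe_set_eq, Nat.card_eq_fintype_card]
  constructor
  · rintro ⟨x, hx, hxC⟩
    by_contra! hlt
    let T : (Fin k → ℂ) →ₗ[ℂ] ({i | B.eigenvalue i ≤ C} → ℂ) :=
      LinearMap.pi fun i => (innerSL ℂ (B.basis i)).toLinearMap ∘ₗ Fintype.linearCombination ℂ x
    have hT : LinearMap.ker T ≠ ⊥ := LinearMap.ker_ne_bot_of_finrank_lt (by
      rw [Module.finrank_fintype_fun_eq_card, Module.finrank_fintype_fun_eq_card, Fintype.card_fin,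
        ← hcard]
      exact hlt)
    obtain ⟨c, hcT, hc0⟩ := Submodule.exists_mem_ne_zero_of_ne_bot hT
    obtain ⟨hy, hyC⟩ := hxC c
    rw [← hx.norm_sum_smul_sq c] at hyC
    set y := ∑ j, c j • x j with hydef
    have hzero : ∀ i, B.eigenvalue i ≤ C → ⟪B.basis i, y⟫_ℂ = 0 := fun i hi =>
      congrFun (LinearMap.mem_ker.1 hcT) ⟨i, hi⟩
    have hy0 : ∃ i, ⟪B.basis i, y⟫_ℂ ≠ 0 := by
      by_contra! h
      have h1 : y = 0 := B.eq_of_forall_inner_eq fun i => by rw [h i, inner_zero_right]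
      exact hc0 (funext fun j => Fintype.linearIndependent_iff.1 hx.linearIndependent c h1 j)
    obtain ⟨i, hi⟩ := hy0
    have hlt : C * ‖y‖ ^ 2 < (a.form ⟨y, hy⟩ ⟨y, hy⟩).re := by
      refine hasSum_lt (fun j => ?_) ?_ ((B.basis.hasSum_norm_inner_sq y).mul_left C)
        (B.hasSum_form ha hc hd ⟨y, hy⟩) (i := i)
      · rcases le_or_gt (B.eigenvalue j) C with h | h
        · simp [hzero j h]
        · exact mul_le_mul_of_nonneg_right h.le (sq_nonneg _)
      · refine mul_lt_mul_of_pos_right ?_ (by positivity)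
        by_contra! h
        exact hi (hzero i h)
    exact absurd hyC (not_le.2 hlt)
  · intro hk
    rw [hcard] at hk
    obtain ⟨f⟩ : Nonempty (Fin k ↪ {i | B.eigenvalue i ≤ C}) :=
      Function.Embedding.nonempty_of_card_le (by rwa [Fintype.card_fin])
    have hx : Orthonormal ℂ (fun j => B.basis (f j)) :=
      B.basis.orthonormal.comp (fun j => (f j : B.ι)) (Subtype.val_injective.comp f.injective)
    refine ⟨_, hx, fun c => ?_⟩
    have hy : ∑ j, c j • B.basis (f j) ∈ a.domain :=
      Submodule.sum_mem _ fun j _ => Submodule.smul_mem _ _ (B.mem_domain hd _)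
    refine ⟨hy, ?_⟩
    rw [← hx.norm_sum_smul_sq c]
    refine hasSum_le (fun i => ?_) (B.hasSum_form ha hc hd ⟨_, hy⟩)
      ((B.basis.hasSum_norm_inner_sq _).mul_left C)
    rcases le_or_gt (B.eigenvalue i) C with h | h
    · exact mul_le_mul_of_nonneg_right h (sq_nonneg _)
    · have : ⟪B.basis i, ∑ j, c j • B.basis (f j)⟫_ℂ = 0 := by
        rw [inner_sum]
        refine Finset.sum_eq_zero fun j _ => ?_
        rw [inner_smul_right, B.basis.orthonormal.2, mul_zero]
        rintro rfl
        exact absurd (f j).2 (not_le.2 h)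
      simp [this]

theorem mem_eigenvalueIndices_iff (B : Eigenbasis a) {k : ℕ} :
    k ∈ LinearPMap.eigenvalueIndices H ↔ 1 ≤ k ∧ (k : ℕ∞) ≤ ENat.card B.ι := by
  rw [B.basis.encard_eq_rank]
  rfl

/-- Over each real number both fibres are finite with the same cardinality, the multiplicity; the
fibrewise bijections are glued. -/
theorem exists_equiv (B : Eigenbasis a) {ev : ℕ → ℝ} (hev : a.operator.IsEigenvalueSequence ev) :
    ∃ σ : LinearPMap.eigenvalueIndices H ≃ B.ι, ∀ k, B.eigenvalue (σ k) = ev k := by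
  have key : ∀ r : ℝ, Nonempty ({k : LinearPMap.eigenvalueIndices H // ev k = r} ≃
      {i // B.eigenvalue i = r}) := by
    intro r
    have h := (hev.2 r).trans (B.encard_eq r).symm
    simp only [Complex.ofReal_inj] at h
    have hfin : {i | B.eigenvalue i = r}.Finite := (B.finite_le r).subset fun i hi => le_of_eq hi
    have hfin' : {k ∈ LinearPMap.eigenvalueIndices H | ev k = r}.Finite := by
      rw [← Set.encard_lt_top_iff, h]
      exact hfin.encard_lt_top
    have := hfin.to_subtype
    have := hfin'.to_subtype
    have hn : Nat.card {k ∈ LinearPMap.eigenvalueIndices H | ev k = r} =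
        Nat.card {i | B.eigenvalue i = r} := by
      rw [Nat.card_coe_set_eq, Nat.card_coe_set_eq, Set.ncard, h, Set.ncard]
    have := Fintype.ofFinite {k ∈ LinearPMap.eigenvalueIndices H | ev k = r}
    have := Fintype.ofFinite {i | B.eigenvalue i = r}
    rw [Nat.card_eq_fintype_card, Nat.card_eq_fintype_card] at hn
    have e : {k ∈ LinearPMap.eigenvalueIndices H | ev k = r} ≃ {i | B.eigenvalue i = r} :=
      Fintype.equivOfCardEq hn
    exact ⟨(Equiv.subtypeSubtypeEquivSubtypeInter (fun k => k ∈ LinearPMap.eigenvalueIndices H)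
      (fun k => ev k = r)).trans e⟩
  have e := fun r => (key r).some
  refine ⟨(Equiv.sigmaFiberEquiv fun k : LinearPMap.eigenvalueIndices H => ev k).symm.trans
    ((Equiv.sigmaCongrRight e).trans (Equiv.sigmaFiberEquiv B.eigenvalue)), fun k => ?_⟩
  exact (e (ev k) ⟨k, rfl⟩).2

/-- By monotonicity the indices with `ev j ≤ C` form an initial segment, whose length is the number
of eigenvalues up to `C`. -/
theorem le_iff_le_ncard (B : Eigenbasis a) {ev : ℕ → ℝ}
    (hev : a.operator.IsEigenvalueSequence ev) {k : ℕ}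
    (hk : k ∈ LinearPMap.eigenvalueIndices H) (C : ℝ) :
    ev k ≤ C ↔ k ≤ {i | B.eigenvalue i ≤ C}.ncard := by
  obtain ⟨σ, hσ⟩ := B.exists_equiv hev
  have himg : {j ∈ LinearPMap.eigenvalueIndices H | ev j ≤ C} =
      (fun i => (σ.symm i : ℕ)) '' {i | B.eigenvalue i ≤ C} := by
    ext j
    constructor
    · rintro ⟨hj, hjC⟩
      refine ⟨σ ⟨j, hj⟩, ?_, by simp⟩
      change B.eigenvalue _ ≤ C
      rwa [hσ]
    · rintro ⟨i, hi, rfl⟩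
      refine ⟨(σ.symm i).2, ?_⟩
      rw [← hσ, Equiv.apply_symm_apply]
      exact hi
  have hcard : {j ∈ LinearPMap.eigenvalueIndices H | ev j ≤ C}.ncard =
      {i | B.eigenvalue i ≤ C}.ncard := by
    rw [himg]
    exact Set.ncard_image_of_injective _ (Subtype.val_injective.comp σ.symm.injective)
  have hfin : {j ∈ LinearPMap.eigenvalueIndices H | ev j ≤ C}.Finite := by
    rw [himg]
    exact (B.finite_le C).image _
  have hmem : ∀ j, 1 ≤ j → j ≤ k → j ∈ LinearPMap.eigenvalueIndices H := fun j h1 hjk =>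
    ⟨h1, le_trans (by exact_mod_cast hjk) hk.2⟩
  rw [← hcard]
  constructor
  · intro h
    have hsub : Set.Icc 1 k ⊆ {j ∈ LinearPMap.eigenvalueIndices H | ev j ≤ C} := fun j hj =>
      ⟨hmem j hj.1 hj.2, (hev.1 (hmem j hj.1 hj.2) hk hj.2).trans h⟩
    have := Set.ncard_le_ncard hsub hfin
    rwa [← Finset.coe_Icc, Set.ncard_coe_finset, Nat.card_Icc, Nat.add_sub_cancel] at this
  · intro h
    by_contra! hlt
    have hsub : {j ∈ LinearPMap.eigenvalueIndices H | ev j ≤ C} ⊆ Set.Icc 1 (k - 1) := by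
      rintro j ⟨hj, hjC⟩
      refine ⟨hj.1, ?_⟩
      by_contra! hkj
      have := hev.1 hk hj (by omega)
      linarith
    have := Set.ncard_le_ncard hsub (Set.finite_Icc _ _)
    rw [← Finset.coe_Icc, Set.ncard_coe_finset, Nat.card_Icc, Nat.add_sub_cancel] at this
    have := hk.1
    omega

theorem exists_isMax (B : Eigenbasis a) {s : Set B.ι} (hs : s.Finite) (hs0 : 0 < s.ncard) :
    ∃ i ∈ s, ∀ j ∈ s, B.eigenvalue j ≤ B.eigenvalue i :=
  Set.exists_max_image s B.eigenvalue hs (Set.nonempty_of_ncard_ne_zero hs0.ne')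

theorem exists_isEigenvalueSequence (B : Eigenbasis a) (hnn : ∀ i, 0 ≤ B.eigenvalue i) :
    ∃ ev : ℕ → ℝ, a.operator.IsEigenvalueSequence ev := by
  set N : ℝ → ℕ := fun C => {i | B.eigenvalue i ≤ C}.ncard with hN
  have hNmono : Monotone N := fun C C' h =>
    Set.ncard_le_ncard (fun i hi => le_trans hi h) (B.finite_le C')
  -- The generalized inverse of the counting function `N`: the least eigenvalue with at least `k`
  -- eigenvalues up to it. Beyond the dimension the set is empty and the value is the irrelevant
  -- default `0`.
  set ev : ℕ → ℝ := fun k => sInf (B.eigenvalue '' {i | k ≤ N (B.eigenvalue i)}) with hevdef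
  have hbdd : ∀ k, BddBelow (B.eigenvalue '' {i | k ≤ N (B.eigenvalue i)}) := fun k =>
    ⟨0, by rintro _ ⟨i, -, rfl⟩; exact hnn i⟩
  have hattain : ∀ k ∈ LinearPMap.eigenvalueIndices H,
      ∃ i, k ≤ N (B.eigenvalue i) ∧ ev k = B.eigenvalue i := by
    intro k hk
    have hne : {i | k ≤ N (B.eigenvalue i)}.Nonempty := by
      obtain ⟨h1, h2⟩ := B.mem_eigenvalueIndices_iff.1 hk
      rw [← Set.encard_univ] at h2
      obtain ⟨t, -, ht⟩ := Set.exists_subset_encard_eq h2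
      have htfin : t.Finite := Set.finite_of_encard_eq_coe ht
      have htn : t.ncard = k := by rw [Set.ncard, ht]; rfl
      obtain ⟨i, -, hi⟩ := B.exists_isMax htfin (by omega)
      exact ⟨i, htn ▸ Set.ncard_le_ncard hi (B.finite_le _)⟩
    obtain ⟨i₀, hi₀⟩ := hne
    -- Cutting off at the eigenvalue of `i₀` makes the set finite, so the infimum is attained.
    obtain ⟨i, ⟨hi, -⟩, hmin⟩ := Set.exists_min_image
      ({i | k ≤ N (B.eigenvalue i)} ∩ {i | B.eigenvalue i ≤ B.eigenvalue i₀}) B.eigenvalue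
      ((B.finite_le _).inter_of_right _) ⟨i₀, hi₀, le_refl (B.eigenvalue i₀)⟩
    refine ⟨i, hi, le_antisymm (csInf_le (hbdd k) ⟨i, hi, rfl⟩)
      (le_csInf ⟨_, i₀, hi₀, rfl⟩ ?_)⟩
    rintro _ ⟨j, hj, rfl⟩
    rcases le_total (B.eigenvalue j) (B.eigenvalue i₀) with h | h
    · exact hmin j ⟨hj, h⟩
    · exact (hmin i₀ ⟨hi₀, le_refl (B.eigenvalue i₀)⟩).trans h
  have hle : ∀ k ∈ LinearPMap.eigenvalueIndices H, ∀ C, ev k ≤ C ↔ k ≤ N C := by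
    intro k hk C
    constructor
    · intro h
      obtain ⟨i, hi, hik⟩ := hattain k hk
      exact hi.trans (hNmono (hik ▸ h))
    · intro h
      obtain ⟨i, hi, hmax⟩ := B.exists_isMax (B.finite_le C) (hk.1.trans h)
      have hsub : N C ≤ N (B.eigenvalue i) := Set.ncard_le_ncard hmax (B.finite_le _)
      exact (csInf_le (hbdd k) ⟨i, h.trans hsub, rfl⟩).trans hi
  have hlt : ∀ k ∈ LinearPMap.eigenvalueIndices H, ∀ C,
      ev k < C ↔ k ≤ {i | B.eigenvalue i < C}.ncard := by
    intro k hk C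
    have hfin : {i | B.eigenvalue i < C}.Finite := (B.finite_le C).subset
        fun i (hi : B.eigenvalue i < _) => hi.le
    constructor
    · intro h
      obtain ⟨i, hi, hik⟩ := hattain k hk
      exact hi.trans (Set.ncard_le_ncard (fun j hj => lt_of_le_of_lt hj (hik ▸ h)) hfin)
    · intro h
      obtain ⟨i, hi, hmax⟩ := B.exists_isMax hfin (hk.1.trans h)
      have hsub : k ≤ N (B.eigenvalue i) := h.trans (Set.ncard_le_ncard hmax (B.finite_le _))
      exact ((hle k hk _).2 hsub).trans_lt hi
  refine ⟨ev, fun k hk k' hk' hkk => ?_, fun z => ?_⟩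
  · exact (hle k hk _).2 (hkk.trans ((hle k' hk' _).1 le_rfl))
  · rw [← B.encard_eq z]
    by_cases hz : z.im = 0
    · obtain ⟨r, rfl⟩ : ∃ r : ℝ, z = (r : ℂ) := ⟨z.re, Complex.ext rfl hz⟩
      simp only [Complex.ofReal_inj]
      have hfin : {i | B.eigenvalue i < r}.Finite := (B.finite_le r).subset
        fun i (hi : B.eigenvalue i < _) => hi.le
      -- The multiplicity of `r` is the jump of the counting function at `r`.
      have hIoc : {k ∈ LinearPMap.eigenvalueIndices H | ev k = r} =
          Set.Ioc {i | B.eigenvalue i < r}.ncard (N r) := by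
        ext k
        constructor
        · rintro ⟨hk, hkr⟩
          exact ⟨not_le.1 fun h => ((hlt k hk r).2 h).ne hkr, (hle k hk r).1 hkr.le⟩
        · rintro ⟨h1, h2⟩
          have hk : k ∈ LinearPMap.eigenvalueIndices H := by
            refine B.mem_eigenvalueIndices_iff.2 ⟨by omega, ?_⟩
            rw [← Set.encard_univ]
            refine le_trans ?_ (Set.encard_le_encard (Set.subset_univ {i | B.eigenvalue i ≤ r}))
            rw [← (B.finite_le r).cast_ncard_eq]
            exact_mod_cast h2
          refine ⟨hk, le_antisymm ((hle k hk r).2 h2) ?_⟩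
          by_contra! h
          exact absurd ((hlt k hk r).1 h) (not_le.2 h1)
      have hdiff : {i | B.eigenvalue i = r} = {i | B.eigenvalue i ≤ r} \ {i | B.eigenvalue i < r} := by
        ext i
        simp only [Set.mem_ofPred_eq, Set.mem_sdiff, not_lt]
        exact ⟨fun h => ⟨h.le, h.ge⟩, fun h => le_antisymm h.1 h.2⟩
      have hsub : {i | B.eigenvalue i < r} ⊆ {i | B.eigenvalue i ≤ r} :=
        fun i (hi : B.eigenvalue i < r) => hi.le
      rw [hIoc, hdiff, ← ((B.finite_le r).sdiff).cast_ncard_eq,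
        Set.ncard_sdiff hsub hfin, ← Finset.coe_Ioc,
        Set.encard_coe_eq_coe_finsetCard, Nat.card_Ioc]
    · have hne : ∀ r : ℝ, (r : ℂ) ≠ z := by
        rintro r rfl
        exact hz (Complex.ofReal_im _)
      simp [hne]

end SesqForm.Eigenbasis

/-! ### The limit form and the passage of test spaces to the limit -/

namespace SesqForm

section

variable {H : Type*} [NormedAddCommGroup H] [InnerProductSpace ℂ H] {D : Submodule ℂ H}
  {a : ℝ → D →ₗ⋆[ℂ] D →ₗ[ℂ] ℂ}

theorem limitForm_isNonneg (ha : IsIncreasing a) : (limitForm a ha).form.IsNonneg :=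
  ⟨fun u => ge_of_tendsto (tendsto_limitForm ha u u)
    (eventually_mem_nhdsWithin.mono fun q hq => (ha.nonneg q hq).nonneg _)⟩

theorem IsIncreasing.re_le (ha : IsIncreasing a) {q q' : ℝ} (hq : 0 < q) (hqq : q ≤ q') (u : D) :
    (a q' u u).re ≤ (a q u u).re := by
  rcases hqq.eq_or_lt with rfl | h
  · exact le_rfl
  · exact (Complex.le_def.1 (ha.mono q q' hq h u)).1

theorem IsIncreasing.sublevel_subset (ha : IsIncreasing a) {q q' : ℝ} (hq : 0 < q) (hqq : q ≤ q')
    (C : ℝ) : (SesqForm.mk D (a q)).sublevel C ⊆ (SesqForm.mk D (a q')).sublevel C :=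
  fun _ ⟨hx, hxC⟩ => ⟨hx, (ha.re_le hq hqq _).trans hxC⟩

/-- On the diagonal the monotone limit is a supremum, and a uniform bound places `x` in the limit
domain. -/
theorem mem_sublevel_limitForm_iff (ha : IsIncreasing a) (C : ℝ) (x : H) :
    x ∈ (limitForm a ha).sublevel C ↔ ∀ q, 0 < q → x ∈ (SesqForm.mk D (a q)).sublevel C := by
  constructor
  · rintro ⟨hx, hxC⟩ q hq
    refine ⟨limitDomain_le ha hx, le_trans ?_ hxC⟩
    refine ge_of_tendsto ((Complex.continuous_re.tendsto _).comp
      (tendsto_limitForm ha ⟨x, hx⟩ ⟨x, hx⟩)) ?_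
    filter_upwards [Ioc_mem_nhdsGT hq] with q' hq'
    exact ha.re_le hq'.1 hq'.2 _
  · intro h
    obtain ⟨hxD, -⟩ := h 1 one_pos
    have hx : x ∈ (limitForm a ha).domain :=
      ⟨hxD, (isBddAlong_iff _).2 ⟨C, fun q hq => (h q hq).2⟩⟩
    refine ⟨hx, le_of_tendsto ((Complex.continuous_re.tendsto _).comp
      (tendsto_limitForm ha ⟨x, hx⟩ ⟨x, hx⟩)) ?_⟩
    filter_upwards [self_mem_nhdsWithin] with q hq
    exact (h q hq).2

theorem IsIncreasing.hasTestSpace_of_le (ha : IsIncreasing a) {q q' : ℝ} (hq : 0 < q)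
    (hqq : q ≤ q') {k : ℕ} {C : ℝ} (h : (SesqForm.mk D (a q)).HasTestSpace k C) :
    (SesqForm.mk D (a q')).HasTestSpace k C :=
  let ⟨x, hx, hxC⟩ := h
  ⟨x, hx, fun c => ha.sublevel_subset hq hqq _ (hxC c)⟩

/-- Its sublevel sets are intersections of closed sets, so the form is lower semicontinuous on `H`,
and this implies closedness. -/
theorem limitForm_isClosed (ha : IsIncreasing a)
    (hcl : ∀ q, 0 < q → ∀ C, _root_.IsClosed ((SesqForm.mk D (a q)).sublevel C)) :
    (limitForm a ha).IsClosed := by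
  have hcl₀ : ∀ C, _root_.IsClosed ((limitForm a ha).sublevel C) := by
    intro C
    have : (limitForm a ha).sublevel C =
        ⋂ (q : ℝ) (_ : 0 < q), (SesqForm.mk D (a q)).sublevel C := by
      ext x
      rw [mem_sublevel_limitForm_iff, Set.mem_iInter₂]
    rw [this]
    exact isClosed_biInter fun q hq => hcl q hq C
  intro u x hux hu
  have hnn := limitForm_isNonneg ha
  have key : ∀ ε > 0, ∃ N, ∀ n ≥ N, (u n : H) - x ∈ (limitForm a ha).sublevel ε := by
    intro ε hε
    have h1 := (Complex.continuous_re.tendsto _).comp hu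
    obtain ⟨⟨N, N'⟩, hN⟩ := eventually_atTop.1 (h1.eventually_lt_const (u := ε) (by simpa using hε))
    refine ⟨N, fun n hn => ?_⟩
    -- With `n` fixed, let `m → ∞` in `u n - u m`, which stays in the closed sublevel set.
    refine (hcl₀ ε).mem_of_tendsto (hux.const_sub (u n : H)) ?_
    filter_upwards [eventually_ge_atTop N'] with m hm
    exact ⟨(u n - u m).2, (hN (n, m) ⟨hn, hm⟩).le⟩
  have hx : x ∈ (limitForm a ha).domain := by
    obtain ⟨N, hN⟩ := key 1 one_pos
    obtain ⟨h, -⟩ := hN N le_rfl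
    simpa using Submodule.sub_mem _ (u N).2 h
  refine ⟨hx, ?_⟩
  have hre : Tendsto (fun n => ((limitForm a ha).form (u n - ⟨x, hx⟩) (u n - ⟨x, hx⟩)).re) atTop
      (𝓝 0) := by
    refine tendsto_order.2 ⟨fun c hc => ?_, fun c hc => ?_⟩
    · exact Eventually.of_forall fun n => hc.trans_le (form_self_re_nonneg hnn _)
    · obtain ⟨N, hN⟩ := key (c / 2) (half_pos hc)
      filter_upwards [eventually_ge_atTop N] with n hn
      obtain ⟨_, h⟩ := hN n hn
      exact lt_of_le_of_lt h (half_lt_self hc)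
  have h2 := (Complex.continuous_ofReal.tendsto 0).comp hre
  rw [Complex.ofReal_zero] at h2
  exact h2.congr fun n => (form_self_eq_re hnn _).symm

/-- Cantor's intersection theorem for the sets `K q` of orthonormal families. For fixed coefficients
`c` the defining condition is closed in the family, since its bound involves only `c`. -/
theorem hasTestSpace_limitForm_iff (ha : IsIncreasing a)
    (hcl : ∀ q, 0 < q → ∀ C, _root_.IsClosed ((SesqForm.mk D (a q)).sublevel C))
    (hcpt : ∀ q, 0 < q → ∀ C,
      IsCompact ((SesqForm.mk D (a q)).sublevel C ∩ Metric.closedBall 0 1)) (k : ℕ) (C : ℝ) :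
    (limitForm a ha).HasTestSpace k C ↔
      ∀ q, 0 < q → (SesqForm.mk D (a q)).HasTestSpace k C := by
  classical
  constructor
  · rintro ⟨x, hx, hxC⟩ q hq
    exact ⟨x, hx, fun c => (mem_sublevel_limitForm_iff ha _ _).1 (hxC c) q hq⟩
  intro h
  let K : Set.Ioi (0 : ℝ) → Set (Fin k → H) := fun q => {x | Orthonormal ℂ x ∧
    ∀ c : Fin k → ℂ, ∑ j, c j • x j ∈ (SesqForm.mk D (a q)).sublevel (C * ∑ j, ‖c j‖ ^ 2)}
  have hmono : ∀ q q' : Set.Ioi (0 : ℝ), q ≤ q' → K q ⊆ K q' := fun q q' hqq x hx =>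
    ⟨hx.1, fun c => ha.sublevel_subset q.2 hqq _ (hx.2 c)⟩
  have hclosed : ∀ q, _root_.IsClosed (K q) := by
    intro q
    have hK : K q = (⋂ (i : Fin k) (j : Fin k),
        {x : Fin k → H | ⟪x i, x j⟫_ℂ = if i = j then 1 else 0}) ∩ ⋂ c : Fin k → ℂ,
        (fun x : Fin k → H => ∑ j, c j • x j) ⁻¹'
          (SesqForm.mk D (a q)).sublevel (C * ∑ j, ‖c j‖ ^ 2) := by
      ext x
      simp only [Set.mem_inter_iff, Set.mem_iInter]
      exact and_congr orthonormal_iff_ite Iff.rfl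
    rw [hK]
    refine (isClosed_iInter fun i => isClosed_iInter fun j =>
      isClosed_eq (by fun_prop) continuous_const).inter ?_
    exact isClosed_iInter fun c => (hcl q q.2 _).preimage (by fun_prop)
  have hcompact : ∀ q, IsCompact (K q) := by
    intro q
    -- Testing with the unit coefficient vectors puts each member of the family in the compact set
    -- `sublevel C ∩ closedBall 0 1`.
    refine (isCompact_univ_pi fun _ : Fin k => hcpt q q.2 C).of_isClosed_subset (hclosed q) ?_
    intro x hx j _
    refine ⟨?_, ?_⟩
    · have := hx.2 (Pi.single j 1)
      have h1 : ∑ i, (Pi.single j 1 : Fin k → ℂ) i • x i = x j := by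
        rw [Finset.sum_eq_single j] <;> simp +contextual
      have h2 : ∑ i, ‖(Pi.single j 1 : Fin k → ℂ) i‖ ^ 2 = 1 := by
        rw [Finset.sum_eq_single j] <;> simp +contextual
      rwa [h1, h2, mul_one] at this
    · rw [mem_closedBall_zero_iff, hx.1.1]
  obtain ⟨x, hx⟩ := IsCompact.nonempty_iInter_of_directed_nonempty_isCompact_isClosed K
    (fun q q' => ⟨min q q', hmono _ _ (min_le_left _ _), hmono _ _ (min_le_right _ _)⟩)
    (fun q => h q q.2) hcompact hclosed
  rw [Set.mem_iInter] at hx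
  exact ⟨x, (hx ⟨1, Set.mem_Ioi.2 one_pos⟩).1, fun c =>
    (mem_sublevel_limitForm_iff ha _ _).2 fun q hq => (hx ⟨q, hq⟩).2 c⟩

end

end SesqForm

/-! ### Convergence of the eigenvalues -/

theorem mainTheorem7 {H : Type*} [NormedAddCommGroup H] [InnerProductSpace ℂ H] [CompleteSpace H]
    (D : Submodule ℂ H) (a : ℝ → D →ₗ⋆[ℂ] D →ₗ[ℂ] ℂ)
    (ha : SesqForm.IsIncreasing a)
    (hclosed : ∀ q : ℝ, 0 < q → (SesqForm.mk D (a q)).IsClosed)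
    (hdense : Dense ((SesqForm.limitForm a ha).domain : Set H))
    (hdisc : ∀ q : ℝ, 0 < q → (SesqForm.mk D (a q)).operator.HasPurelyDiscreteSpectrum)
    (hdisc₀ : (SesqForm.limitForm a ha).operator.HasPurelyDiscreteSpectrum) :
    (∀ q : ℝ, 0 < q → ∃ ev : ℕ → ℝ, (SesqForm.mk D (a q)).operator.IsEigenvalueSequence ev) ∧
    (∃ ev₀ : ℕ → ℝ, (SesqForm.limitForm a ha).operator.IsEigenvalueSequence ev₀) ∧
    ∀ (ev : ℝ → ℕ → ℝ) (ev₀ : ℕ → ℝ),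
      (∀ q : ℝ, 0 < q → (SesqForm.mk D (a q)).operator.IsEigenvalueSequence (ev q)) →
      (SesqForm.limitForm a ha).operator.IsEigenvalueSequence ev₀ →
      ∀ k ∈ LinearPMap.eigenvalueIndices H,
        Tendsto (fun q => ev q k) (𝓝[>] 0) (𝓝 (ev₀ k)) := by
  have hD : Dense (D : Set H) := hdense.mono (SesqForm.limitDomain_le ha)
  have hB : ∀ q, 0 < q → Nonempty (SesqForm.mk D (a q)).Eigenbasis := fun q hq =>
    SesqForm.nonempty_eigenbasis (ha.nonneg q hq) (hclosed q hq) hD (hdisc q hq)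
  have hcl : ∀ q, 0 < q → ∀ C, IsClosed ((SesqForm.mk D (a q)).sublevel C) := fun q hq C =>
    (hB q hq).some.isClosed_sublevel (ha.nonneg q hq) (hclosed q hq) hD C
  have hcpt : ∀ q, 0 < q → ∀ C,
      IsCompact ((SesqForm.mk D (a q)).sublevel C ∩ Metric.closedBall 0 1) := fun q hq C =>
    (hB q hq).some.isCompact_sublevel (ha.nonneg q hq) (hclosed q hq) hD C
  have hnn₀ := SesqForm.limitForm_isNonneg ha
  have hclosed₀ := SesqForm.limitForm_isClosed ha hcl
  obtain ⟨B₀⟩ := SesqForm.nonempty_eigenbasis hnn₀ hclosed₀ hdense hdisc₀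
  refine ⟨fun q hq => ?_, ?_, ?_⟩
  · obtain ⟨B⟩ := hB q hq
    exact B.exists_isEigenvalueSequence (B.eigenvalue_nonneg (ha.nonneg q hq) hD)
  · exact B₀.exists_isEigenvalueSequence (B₀.eigenvalue_nonneg hnn₀ hdense)
  · intro ev ev₀ hev hev₀ k hk
    have hiff : ∀ q, 0 < q → ∀ C, ev q k ≤ C ↔ (SesqForm.mk D (a q)).HasTestSpace k C := by
      intro q hq C
      obtain ⟨B⟩ := hB q hq
      rw [B.le_iff_le_ncard (hev q hq) hk, B.hasTestSpace_iff (ha.nonneg q hq) (hclosed q hq) hD]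
    have hiff₀ : ∀ C, ev₀ k ≤ C ↔ ∀ q, 0 < q → (SesqForm.mk D (a q)).HasTestSpace k C := by
      intro C
      rw [B₀.le_iff_le_ncard hev₀ hk, ← B₀.hasTestSpace_iff hnn₀ hclosed₀ hdense,
        SesqForm.hasTestSpace_limitForm_iff ha hcl hcpt]
    refine tendsto_order.2 ⟨fun c hc => ?_, fun c hc => ?_⟩
    -- For `c < ev₀ k` some `a q₀` has no test space at level `c`; by monotonicity no `a q` with `q
    -- ≤ q₀` has one either.
    · have h := mt (hiff₀ c).2 (not_le.2 hc)
      push Not at h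
      obtain ⟨q₀, hq₀, hq₀c⟩ := h
      filter_upwards [Ioc_mem_nhdsGT hq₀] with q hq
      by_contra! hle
      exact hq₀c (ha.hasTestSpace_of_le hq.1 hq.2 ((hiff q hq.1 c).1 hle))
    -- The limit eigenvalue bounds `ev q k` from above for every `q > 0`.
    · filter_upwards [self_mem_nhdsWithin] with q hq
      exact ((hiff q hq _).2 ((hiff₀ _).1 le_rfl q hq)).trans_lt hc
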